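/- Let $B$ be a unital algebra over $\mathbb{C}$. A *$B$-$B$-non-commutative probability space* $(\mathcal{A},E,\varepsilon)$ is a unital complex algebra $\mathcal{A}$ with a unital homomorphism $\varepsilon : B\otimes B^{\mathrm{op}}\to\mathcal{A}$ that is injective on $B\otimes 1$ and on $1\otimes B^{\mathrm{op}}$, and a linear map $E:\mathcal{A}\to B$ with $E(L_{b_1}R_{b_2}T)=b_1E(T)b_2$ and $E(TL_b)=E(TR_b)$, where $L_b=\varepsilon(b\otimes 1)$ and $R_b=\varepsilon(1\otimes b)$. Let $\mathcal{A}_\ell$ (resp. $\mathcal{A}_r$) be the commutant of $\{R_b\}_{b\in B}$ (resp. $\{L_b\}_{b\in B}$) in $\mathcal{A}$. A *pair of $B$-faces* is a pair $(C,D)$ of unital subalgebras with $\{L_b\}\subseteq C\subseteq\mathcal{A}_\ell$ and $\{R_b\}\subseteq D\subseteq\mathcal{A}_r$. A family $\{(C_k,D_k)\}_{k\in K}$ of pairs of $B$-faces is *bi-free over $B$* if there are $B$-$B$-bimodules $\mathcal{X}_k=B\oplus\mathring{\mathcal{X}}_k$ and unital homomorphisms $l_k:C_k\to\mathcal{L}_\ell(\mathcal{X}_k)$,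 $r_k:D_k\to\mathcal{L}_r(\mathcal{X}_k)$ into the right $B$-linear (resp. left $B$-linear) operators such that the $B$-valued joint distribution of the family under $E$ (the values of $E$ at products of elements of the $C_k$, elements of the $D_k$ and coefficients $L_b,R_b$) equals that of the images $\lambda_k(l_k(C_k)),\rho_k(r_k(D_k))$ on the reduced free product $$\mathcal{X}=B\oplus\bigoplus_{n\ge1}\bigoplus_{k_1\ne\cdots\ne k_n}\mathring{\mathcal{X}}_{k_1}\otimes_B\cdots\otimes_B\mathring{\mathcal{X}}_{k_n}$$ under $T\mapsto p(T1_B)$. Here $p:\mathcal{X}\to B$ is the projection, $L_b$ and $R_b$ act on $\mathcal{X}$ by left and right multiplication, and $\lambda_k$ (resp. $\rho_k$) is the action on the leftmost (resp. rightmost) tensor factor, after splitting off a factor $\mathcal{X}_k$ on that side. On $\ell^2(\mathbb{Z},B)$ (finitely supported sequences $(b_k)_{k\in\mathbb{Z}}$ in $B$, with the expectation $T\mapsto (T\delta_0)_0$) let $U_{\mathrm{Haar}}((b_k)_k)=(b_{k+1})_k$. A *$B$-valued Haar bi-unitary* in $\mathcal{A}$ is a pair of invertible elements $U_\ell\in\mathcal{A}_\ell$,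 $U_r\in\mathcal{A}_r$ such that all moments $E(z_1C_{b_1}z_2C_{b_2}\cdots z_{n-1}C_{b_{n-1}}z_n)$, with $z_i\in\{U_\ell,U_\ell^{-1},U_r,U_r^{-1}\}$, $b_i\in B$, and $C_{b_i}=L_{b_i}$ if $z_i\in\{U_\ell,U_\ell^{-1}\}$ and $C_{b_i}=R_{b_i}$ otherwise, agree with those obtained when $U_\ell$ and $U_r$ are both replaced by $U_{\mathrm{Haar}}$. The pair of $B$-faces it generates is $(\mathrm{alg}(\{L_b\},U_\ell,U_\ell^{-1}),\mathrm{alg}(\{R_b\},U_r,U_r^{-1}))$. **Theorem.** Let $(\mathcal{A},E,\varepsilon)$ be a $B$-$B$-non-commutative probability space, let $(C,D)$ be a pair of $B$-faces, and let $(U_\ell,U_r)$ be a $B$-valued Haar bi-unitary in $\mathcal{A}$ such that $(C,D)$ and the pair of $B$-faces generated by $(U_\ell,U_r)$ are bi-free over $B$. Let $(C',D')$ be the pair of $B$-faces generated by $U_\ell^{-1}CU_\ell$ and $U_rDU_r^{-1}$, that is $C'=\mathrm{alg}(\{L_b\}_{b\in B}\cup U_\ell^{-1}CU_\ell)$ and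 $D'=\mathrm{alg}(\{R_b\}_{b\in B}\cup U_rDU_r^{-1})$. Then $(C,D)$ and $(C',D')$ are bi-free over $B$. Moreover, $(U_\ell^{-1}CU_\ell,U_rDU_r^{-1})$ has the same $B$-valued joint distribution as $(C,D)$: the value of $E$ at a product of elements $c\in C$, $d\in D$ and coefficients $L_b,R_b$ does not change if every $c$ is replaced by $U_\ell^{-1}cU_\ell$ and every $d$ by $U_rdU_r^{-1}$, the coefficients being kept. -/

import Mathlib

open scoped TensorProduct

universe u v w

set_option linter.unusedSimpArgs false

noncomputable section

namespace BiFree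

/-! ### Bimodules with a specified vector state and their left and right algebras -/

/-- A `B`-`B`-bimodule over the complex algebra `B` (the two induced complex structures agree). -/
structure BBimodule (B : Type u) [Ring B] [Algebra ℂ B] where
  carrier : Type w
  [addCommGroup : AddCommGroup carrier]
  [moduleComplex : Module ℂ carrier]
  [moduleLeft : Module B carrier]
  [moduleRight : Module Bᵐᵒᵖ carrier]
  [smulComm : SMulCommClass B Bᵐᵒᵖ carrier]
  [towerLeft : IsScalarTower ℂ B carrier]
  [towerRight : IsScalarTower ℂ Bᵐᵒᵖ carrier]

attribute [instance] BBimodule.addCommGroup BBimodule.moduleComplex BBimodule.moduleLeft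
  BBimodule.moduleRight BBimodule.smulComm BBimodule.towerLeft BBimodule.towerRight

/-- The `B`-`B`-bimodule with specified vector state `𝒳 = B ⊕ 𝒳°`, given by `𝒳°`. The vector state
`p` is the first projection, and `1_B ⊕ 0` is `(1, 0)`. -/
abbrev Pointed {B : Type u} [Ring B] [Algebra ℂ B] (X : BBimodule.{u, w} B) : Type (max u w) :=
  B × X.carrier

section Operators

variable {B : Type u} [Ring B] [Algebra ℂ B]

/-- `L_b η = b · η` on a bimodule. -/
def opL (M : Type w) [AddCommGroup M] [Module ℂ M] [Module B M] [IsScalarTower ℂ B M] (b : B) :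
    Module.End ℂ M :=
  Algebra.lsmul ℂ ℂ M b

/-- `R_b η = η · b` on a bimodule. -/
def opR (M : Type w) [AddCommGroup M] [Module ℂ M] [Module Bᵐᵒᵖ M] [IsScalarTower ℂ Bᵐᵒᵖ M]
    (b : B) : Module.End ℂ M :=
  Algebra.lsmul ℂ ℂ M (MulOpposite.op b)

/-- The left algebra `ℒ_ℓ(𝒳)`: the operators that commute with all `R_b`. -/
def leftOperators (X : BBimodule.{u, w} B) : Subalgebra ℂ (Module.End ℂ (Pointed X)) :=
  Subalgebra.centralizer ℂ (Set.range (opR (B := B) (Pointed X)))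

/-- The right algebra `ℒ_r(𝒳)`: the operators that commute with all `L_b`. -/
def rightOperators (X : BBimodule.{u, w} B) : Subalgebra ℂ (Module.End ℂ (Pointed X)) :=
  Subalgebra.centralizer ℂ (Set.range (opL (B := B) (Pointed X)))

lemma leftOperators_smul {X : BBimodule.{u, w} B} (T : leftOperators X) (v : Pointed X) (b : B) :
    T.1 (MulOpposite.op b • v) = MulOpposite.op b • T.1 v := by
  have h := (Subalgebra.mem_centralizer_iff ℂ).1 T.2 _ ⟨b, rfl⟩
  exact (LinearMap.congr_fun h v).symm

lemma rightOperators_smul {X : BBimodule.{u, w} B} (T : rightOperators X) (v : Pointed X) (b : B) :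
    T.1 (b • v) = b • T.1 v := by
  have h := (Subalgebra.mem_centralizer_iff ℂ).1 T.2 _ ⟨b, rfl⟩
  exact (LinearMap.congr_fun h v).symm

end Operators

/-! ### The reduced free product with amalgamation over `B` -/

section FreeProduct

variable {B : Type u} [Ring B] [Algebra ℂ B] {K : Type*} (X : K → BBimodule.{u, w} B)

/-- Lists of vectors `x₁, …, xₙ` with `xᵢ ∈ 𝒳°_{kᵢ}`. -/
abbrev Word : Type _ := List (Σ k, (X k).carrier)

variable {X} in
/-- The indices satisfy `k₁ ≠ k₂ ≠ ⋯ ≠ kₙ`. -/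
def Word.Alternating (l : Word X) : Prop := (l.map Sigma.fst).IsChain (· ≠ ·)

/-- The relations that turn formal words `b · x₁ ⊗ ⋯ ⊗ xₙ` into elements of
`B ⊕ ⨁_{n ≥ 1} ⨁_{k₁ ≠ ⋯ ≠ kₙ} 𝒳°_{k₁} ⊗_B ⋯ ⊗_B 𝒳°_{kₙ}`: linearity in all entries, balance over
`B` at each tensor sign, and the vanishing of the words with two equal neighbouring indices.
(Complex homogeneity in `xᵢ` follows from that in `b` and from balance.) -/
inductive FreeRel : (B × Word X →₀ ℂ) → Prop
  | add_coeff (b b' : B) (l : Word X) :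
      FreeRel (.single (b + b', l) 1 - .single (b, l) 1 - .single (b', l) 1)
  | smul_coeff (c : ℂ) (b : B) (l : Word X) :
      FreeRel (.single (c • b, l) 1 - c • .single (b, l) 1)
  | add_entry (b : B) (l : Word X) (k : K) (x y : (X k).carrier) (l' : Word X) :
      FreeRel (.single (b, l ++ ⟨k, x + y⟩ :: l') 1 - .single (b, l ++ ⟨k, x⟩ :: l') 1
        - .single (b, l ++ ⟨k, y⟩ :: l') 1)
  | balance (b : B) (l : Word X) (j : K) (x : (X j).carrier) (c : B) (k : K) (y : (X k).carrier)
      (l' : Word X) :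
      FreeRel (.single (b, l ++ ⟨j, MulOpposite.op c • x⟩ :: ⟨k, y⟩ :: l') 1
        - .single (b, l ++ ⟨j, x⟩ :: ⟨k, c • y⟩ :: l') 1)
  | balance_coeff (b c : B) (k : K) (x : (X k).carrier) (l : Word X) :
      FreeRel (.single (b * c, ⟨k, x⟩ :: l) 1 - .single (b, ⟨k, c • x⟩ :: l) 1)
  | repeated (b : B) (l : Word X) (k : K) (x y : (X k).carrier) (l' : Word X) :
      FreeRel (.single (b, l ++ ⟨k, x⟩ :: ⟨k, y⟩ :: l') 1)

/-- The free product with amalgamation over `B` of the pointed bimodules `B ⊕ 𝒳°_k`. -/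
abbrev FreeProd : Type _ :=
  (B × Word X →₀ ℂ) ⧸ Submodule.span ℂ {r | FreeRel X r}

/-- The vector `b · x₁ ⊗ ⋯ ⊗ xₙ` of the free product (which is `b ∈ B` if `n = 0`). -/
def tens (b : B) (l : Word X) : FreeProd X :=
  Submodule.Quotient.mk (Finsupp.single (b, l) 1)

variable {X}

lemma mk_eq_zero_of_rel {r : B × Word X →₀ ℂ} (h : FreeRel X r) :
    (Submodule.Quotient.mk r : FreeProd X) = 0 :=
  (Submodule.Quotient.mk_eq_zero _).2 (Submodule.subset_span h)

lemma tens_add_coeff (b b' : B) (l : Word X) : tens X (b + b') l = tens X b l + tens X b' l := by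
  have h := mk_eq_zero_of_rel (FreeRel.add_coeff (X := X) b b' l)
  rw [Submodule.Quotient.mk_sub, Submodule.Quotient.mk_sub, sub_sub, sub_eq_zero] at h
  exact h

lemma tens_smul_coeff (c : ℂ) (b : B) (l : Word X) : tens X (c • b) l = c • tens X b l := by
  have h := mk_eq_zero_of_rel (FreeRel.smul_coeff (X := X) c b l)
  rw [Submodule.Quotient.mk_sub, Submodule.Quotient.mk_smul, sub_eq_zero] at h
  exact h

lemma tens_add (b : B) (l : Word X) (k : K) (x y : (X k).carrier) (l' : Word X) :
    tens X b (l ++ ⟨k, x + y⟩ :: l') =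
      tens X b (l ++ ⟨k, x⟩ :: l') + tens X b (l ++ ⟨k, y⟩ :: l') := by
  have h := mk_eq_zero_of_rel (FreeRel.add_entry b l k x y l')
  rw [Submodule.Quotient.mk_sub, Submodule.Quotient.mk_sub, sub_sub, sub_eq_zero] at h
  exact h

lemma tens_balance (b : B) (l : Word X) (j : K) (x : (X j).carrier) (c : B) (k : K)
    (y : (X k).carrier) (l' : Word X) :
    tens X b (l ++ ⟨j, MulOpposite.op c • x⟩ :: ⟨k, y⟩ :: l') =
      tens X b (l ++ ⟨j, x⟩ :: ⟨k, c • y⟩ :: l') := by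
  have h := mk_eq_zero_of_rel (FreeRel.balance b l j x c k y l')
  rw [Submodule.Quotient.mk_sub, sub_eq_zero] at h
  exact h

lemma tens_balance_coeff (b c : B) (k : K) (x : (X k).carrier) (l : Word X) :
    tens X (b * c) (⟨k, x⟩ :: l) = tens X b (⟨k, c • x⟩ :: l) := by
  have h := mk_eq_zero_of_rel (FreeRel.balance_coeff b c k x l)
  rw [Submodule.Quotient.mk_sub, sub_eq_zero] at h
  exact h

lemma tens_repeated (b : B) (l : Word X) (k : K) (x y : (X k).carrier) (l' : Word X) :
    tens X b (l ++ ⟨k, x⟩ :: ⟨k, y⟩ :: l') = 0 :=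
  mk_eq_zero_of_rel (FreeRel.repeated b l k x y l')

lemma tens_smul (b : B) (l : Word X) (k : K) (c : ℂ) (x : (X k).carrier) (l' : Word X) :
    tens X b (l ++ ⟨k, c • x⟩ :: l') = c • tens X b (l ++ ⟨k, x⟩ :: l') := by
  induction l using List.reverseRecOn generalizing k x l' with
  | nil =>
    have h : c • x = (c • (1 : B)) • x := by rw [smul_assoc, one_smul]
    rw [List.nil_append, List.nil_append, h, ← tens_balance_coeff, mul_smul_comm, mul_one,
      tens_smul_coeff]
  | append_singleton l a ih =>
    obtain ⟨j, y⟩ := a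
    have h : c • x = (c • (1 : B)) • x := by rw [smul_assoc, one_smul]
    have h' : MulOpposite.op (c • (1 : B)) • y = c • y := by
      rw [MulOpposite.op_smul, smul_assoc, MulOpposite.op_one, one_smul]
    simp only [List.append_assoc, List.cons_append, List.nil_append]
    rw [h, ← tens_balance, h', ih]

/-- The properties that let a function of formal words define a linear map on the free product. -/
structure Compatible {Y : Type*} [AddCommGroup Y] [Module ℂ Y] (f : B → Word X → Y) : Prop where
  add_coeff : ∀ (b b' : B) (l : Word X), f (b + b') l = f b l + f b' l
  smul_coeff : ∀ (c : ℂ) (b : B) (l : Word X), f (c • b) l = c • f b l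
  add_entry : ∀ (b : B) (l : Word X) (k : K) (x y : (X k).carrier) (l' : Word X),
    f b (l ++ ⟨k, x + y⟩ :: l') = f b (l ++ ⟨k, x⟩ :: l') + f b (l ++ ⟨k, y⟩ :: l')
  balance : ∀ (b : B) (l : Word X) (j : K) (x : (X j).carrier) (c : B) (k : K)
    (y : (X k).carrier) (l' : Word X),
    f b (l ++ ⟨j, MulOpposite.op c • x⟩ :: ⟨k, y⟩ :: l') = f b (l ++ ⟨j, x⟩ :: ⟨k, c • y⟩ :: l')
  balance_coeff : ∀ (b c : B) (k : K) (x : (X k).carrier) (l : Word X),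
    f (b * c) (⟨k, x⟩ :: l) = f b (⟨k, c • x⟩ :: l)

open Classical in
/-- The linear map on the free product with value `f b l` at `tens X b l` for each alternating
word `l` (on the other words `tens X b l = 0`). -/
def liftFree {Y : Type*} [AddCommGroup Y] [Module ℂ Y] (f : B → Word X → Y) (hf : Compatible f) :
    FreeProd X →ₗ[ℂ] Y :=
  Submodule.liftQ _
    (Finsupp.linearCombination ℂ
      (fun a : B × Word X => if Word.Alternating a.2 then f a.1 a.2 else 0)) <| by
    rw [Submodule.span_le]
    rintro r (hr : FreeRel X r)
    rw [SetLike.mem_coe, LinearMap.mem_ker]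
    cases hr with
    | add_coeff b b' l =>
      by_cases h : Word.Alternating l <;> simp [h, hf.add_coeff]
    | smul_coeff c b l =>
      by_cases h : Word.Alternating l <;> simp [h, hf.smul_coeff]
    | add_entry b l k x y l' =>
      by_cases h : ((l.map Sigma.fst) ++ k :: l'.map Sigma.fst).IsChain (· ≠ ·) <;>
        simp [Word.Alternating, h, hf.add_entry]
    | balance b l j x c k y l' =>
      by_cases h : ((l.map Sigma.fst) ++ j :: k :: l'.map Sigma.fst).IsChain (· ≠ ·) <;>
        simp [Word.Alternating, h, hf.balance]
    | balance_coeff b c k x l =>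
      by_cases h : (k :: l.map Sigma.fst).IsChain (· ≠ ·) <;>
        simp [Word.Alternating, h, hf.balance_coeff]
    | repeated b l k x y l' =>
      have h : ¬ ((l.map Sigma.fst) ++ k :: k :: l'.map Sigma.fst).IsChain (· ≠ ·) := by
        intro h
        have h2 := h.right_of_append
        simp at h2
      simp [Word.Alternating, h]

lemma liftFree_tens {Y : Type*} [AddCommGroup Y] [Module ℂ Y] (f : B → Word X → Y)
    (hf : Compatible f) (b : B) (l : Word X) (hl : Word.Alternating l) :
    liftFree f hf (tens X b l) = f b l := by
  simp [liftFree, tens, hl]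

variable (X)

/-- The specified vector state `p : 𝒳 → B` of the free product. -/
def vectorState : FreeProd X →ₗ[ℂ] B :=
  liftFree (fun b l => match l with
    | [] => b
    | _ :: _ => 0) <| by
    constructor
    · rintro b b' (_ | ⟨a, l⟩) <;> simp
    · rintro c b (_ | ⟨a, l⟩) <;> simp
    · rintro b (_ | ⟨a, l⟩) k x y l' <;> simp
    · rintro b (_ | ⟨a, l⟩) j x c k y l' <;> simp
    · intros; simp

/-- The expectation `E(T) = p(T 1_B)` on the operators of the free product. -/
def freeExpectation (T : Module.End ℂ (FreeProd X)) : B := vectorState X (T (tens X 1 []))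

/-- `L_b` on the free product. -/
def freeL (b : B) : Module.End ℂ (FreeProd X) :=
  liftFree (fun b' l => tens X (b * b') l) <| by
    constructor
    · intros; rw [mul_add, tens_add_coeff]
    · intros; rw [mul_smul_comm, tens_smul_coeff]
    · intros; rw [tens_add]
    · intros; rw [tens_balance]
    · intros; rw [← mul_assoc, tens_balance_coeff]

variable {X} in
/-- `(b · x₁ ⊗ ⋯ ⊗ xₙ) · c`, as a function of the formal word read from the right. -/
def rightMul (c b : B) : Word X → FreeProd X
  | [] => tens X (b * c) []
  | ⟨k, x⟩ :: m => tens X b (⟨k, MulOpposite.op c • x⟩ :: m).reverse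

lemma rightMul_compatible (c : B) :
    Compatible (X := X) (fun b l => rightMul c b l.reverse) := by
  constructor
  · intro b b' l
    rcases l.reverse with _ | ⟨⟨k, x⟩, m⟩ <;> simp [rightMul, add_mul, tens_add_coeff]
  · intro c b l
    rcases l.reverse with _ | ⟨⟨k, x⟩, m⟩ <;> simp [rightMul, tens_smul_coeff]
  · intro b l k x y l'
    rcases List.eq_nil_or_concat l' with rfl | ⟨l', ⟨j, z⟩, rfl⟩
    · simp [rightMul, smul_add, tens_add]
    · simp [rightMul, tens_add]
  · intro b l j x d k y l'
    rcases List.eq_nil_or_concat l' with rfl | ⟨l', ⟨j, z⟩, rfl⟩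
    · simp [rightMul, tens_balance, smul_comm]
    · simp [rightMul, tens_balance]
  · intro b d k x l
    rcases List.eq_nil_or_concat l with rfl | ⟨l', ⟨j, z⟩, rfl⟩
    · simp [rightMul, tens_balance_coeff, smul_comm]
    · simp [rightMul, tens_balance_coeff]

/-- `R_b` on the free product. -/
def freeR (b : B) : Module.End ℂ (FreeProd X) :=
  liftFree (fun b' l => rightMul b b' l.reverse) (rightMul_compatible X b)

open Classical in
/-- Splits off a first entry from `𝒳_k = B ⊕ 𝒳°_k`: the word `x₁ ⊗ x₂ ⊗ ⋯` is sent to the pair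
`x₁, x₂ ⊗ ⋯` if `x₁ ∈ 𝒳°_k` and to the pair `1_B, x₁ ⊗ x₂ ⊗ ⋯` otherwise. -/
def split (k : K) : Word X → Pointed (X k) × Word X
  | [] => ((1, 0), [])
  | ⟨j, x⟩ :: l => if h : j = k then ((0, h ▸ x), l) else ((1, 0), ⟨j, x⟩ :: l)

variable {X}

lemma split_self (k : K) (x : (X k).carrier) (l : Word X) :
    split X k (⟨k, x⟩ :: l) = ((0, x), l) := by
  simp [split]

lemma split_ne {k j : K} (h : j ≠ k) (x : (X j).carrier) (l : Word X) :
    split X k (⟨j, x⟩ :: l) = ((1, 0), ⟨j, x⟩ :: l) := by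
  simp [split, h]

/-- `(c ⊕ z) ⊗ x₁ ⊗ ⋯ ⊗ xₙ` for `c ⊕ z ∈ 𝒳_k`, that is `c · x₁ ⊗ ⋯ ⊗ xₙ + z ⊗ x₁ ⊗ ⋯ ⊗ xₙ`. -/
def consVec (k : K) (v : Pointed (X k)) (l : Word X) : FreeProd X :=
  tens X v.1 l + tens X 1 (⟨k, v.2⟩ :: l)

/-- `b · x₁ ⊗ ⋯ ⊗ xₙ ⊗ (c ⊕ z)` for `c ⊕ z ∈ 𝒳_k`, as a function of the word read from the
right, that is `(b · x₁ ⊗ ⋯ ⊗ xₙ) · c + b · x₁ ⊗ ⋯ ⊗ xₙ ⊗ z`. -/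
def snocVec (k : K) (v : Pointed (X k)) (b : B) (m : Word X) : FreeProd X :=
  rightMul v.1 b m + tens X b (⟨k, v.2⟩ :: m).reverse

lemma consVec_add (k : K) (v v' : Pointed (X k)) (l : Word X) :
    consVec k (v + v') l = consVec k v l + consVec k v' l := by
  have h := tens_add (1 : B) [] k v.2 v'.2 l
  simp only [List.nil_append] at h
  simp only [consVec, Prod.fst_add, Prod.snd_add, tens_add_coeff, h]
  abel

lemma consVec_smul (k : K) (c : ℂ) (v : Pointed (X k)) (l : Word X) :
    consVec k (c • v) l = c • consVec k v l := by
  have h := tens_smul (1 : B) [] k c v.2 l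
  simp only [List.nil_append] at h
  simp only [consVec, Prod.smul_fst, Prod.smul_snd, tens_smul_coeff, h, smul_add]

lemma consVec_balance (k : K) (v : Pointed (X k)) (c : B) (j : K) (x : (X j).carrier)
    (l : Word X) :
    consVec k (MulOpposite.op c • v) (⟨j, x⟩ :: l) = consVec k v (⟨j, c • x⟩ :: l) := by
  have h := tens_balance (1 : B) [] k v.2 c j x l
  simp only [List.nil_append] at h
  simp only [consVec, Prod.smul_fst, Prod.smul_snd, h, MulOpposite.smul_eq_mul_unop,
    MulOpposite.unop_op, tens_balance_coeff]

lemma consVec_add_entry (k : K) (v : Pointed (X k)) (l : Word X) (j : K) (x y : (X j).carrier)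
    (l' : Word X) :
    consVec k v (l ++ ⟨j, x + y⟩ :: l') =
      consVec k v (l ++ ⟨j, x⟩ :: l') + consVec k v (l ++ ⟨j, y⟩ :: l') := by
  have h := tens_add (1 : B) (⟨k, v.2⟩ :: l) j x y l'
  simp only [List.cons_append] at h
  simp only [consVec, tens_add v.1 l, h]
  abel

lemma consVec_balance_entry (k : K) (v : Pointed (X k)) (l : Word X) (i : K) (x : (X i).carrier)
    (c : B) (j : K) (y : (X j).carrier) (l' : Word X) :
    consVec k v (l ++ ⟨i, MulOpposite.op c • x⟩ :: ⟨j, y⟩ :: l') =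
      consVec k v (l ++ ⟨i, x⟩ :: ⟨j, c • y⟩ :: l') := by
  have h := tens_balance (1 : B) (⟨k, v.2⟩ :: l) i x c j y l'
  simp only [List.cons_append] at h
  simp only [consVec, tens_balance v.1 l, h]

lemma leftAct_compatible (k : K) (T : leftOperators (X k)) :
    Compatible (X := X)
      (fun b l => consVec k (T.1 (b • (split X k l).1)) (split X k l).2) := by
  have hmul : ∀ b c : B, (b * c, (0 : (X k).carrier)) = MulOpposite.op c • (b, 0) := by
    intro b c; ext <;> simp
  constructor
  · intro b b' l
    simp only [add_smul, map_add, consVec_add]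
  · intro c b l
    simp only [smul_assoc, map_smul, consVec_smul]
  · rintro b (_ | ⟨⟨i, z⟩, l⟩) j x y l'
    · by_cases h : j = k
      · subst h
        have e : ((0 : B), b • x + b • y) = (0, b • x) + (0, b • y) := by ext <;> simp
        simp only [List.nil_append, split, dite_true, Prod.smul_mk, smul_zero, smul_add]
        rw [e, map_add, consVec_add]
      · simpa [split, h] using consVec_add_entry k (T.1 (b, 0)) [] j x y l'
    · by_cases h : i = k
      · subst h
        simp [split, consVec_add_entry]
      · simpa [split, h] using consVec_add_entry k (T.1 (b, 0)) (⟨i, z⟩ :: l) j x y l'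
  · rintro b (_ | ⟨⟨i, z⟩, l⟩) j x c m y l'
    · by_cases h : j = k
      · subst h
        have e : ((0 : B), b • MulOpposite.op c • x) = MulOpposite.op c • (0, b • x) := by
          ext <;> simp [smul_comm]
        simp only [List.nil_append, split, dite_true, Prod.smul_mk, smul_zero]
        rw [e, leftOperators_smul, consVec_balance]
      · simpa [split, h] using consVec_balance_entry k (T.1 (b, 0)) [] j x c m y l'
    · by_cases h : i = k
      · subst h
        simp [split, consVec_balance_entry]
      · simpa [split, h] using consVec_balance_entry k (T.1 (b, 0)) (⟨i, z⟩ :: l) j x c m y l'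
  · intro b c j x l
    by_cases h : j = k
    · subst h
      simp [split, mul_smul]
    · simp only [split, h, dite_false, Prod.smul_mk, smul_zero, smul_eq_mul, mul_one]
      rw [hmul, leftOperators_smul, consVec_balance]

/-- The left representation `λ_k : ℒ_ℓ(𝒳_k) → ℒ(𝒳)`, `T ↦ V_k⁻¹ (T ⊗ I) V_k`. -/
def leftAct (k : K) (T : leftOperators (X k)) : Module.End ℂ (FreeProd X) :=
  liftFree (fun b l => consVec k (T.1 (b • (split X k l).1)) (split X k l).2)
    (leftAct_compatible k T)

lemma rightMul_add_coeff (c c' b : B) (m : Word X) :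
    rightMul (c + c') b m = rightMul c b m + rightMul c' b m := by
  rcases m with _ | ⟨⟨k, x⟩, m⟩
  · simp [rightMul, mul_add, tens_add_coeff]
  · simp [rightMul, add_smul, tens_add]

lemma snocVec_add (k : K) (v v' : Pointed (X k)) (b : B) (m : Word X) :
    snocVec k (v + v') b m = snocVec k v b m + snocVec k v' b m := by
  simp only [snocVec, Prod.fst_add, Prod.snd_add, rightMul_add_coeff, List.reverse_cons, tens_add]
  abel

lemma snocVec_balance (k : K) (v : Pointed (X k)) (b c : B) (j : K) (x : (X j).carrier)
    (m : Word X) :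
    snocVec k v b (⟨j, MulOpposite.op c • x⟩ :: m) = snocVec k (c • v) b (⟨j, x⟩ :: m) := by
  simp [snocVec, rightMul, tens_balance, mul_smul]

lemma snocVec_balance_nil (k : K) (v : Pointed (X k)) (b c : B) :
    snocVec k v (b * c) [] = snocVec k (c • v) b [] := by
  simp [snocVec, rightMul, tens_balance_coeff, mul_assoc]

lemma snocVec_compatible (k : K) (v : Pointed (X k)) :
    Compatible (X := X) (fun b l => snocVec k v b l.reverse) := by
  have h := rightMul_compatible X v.1
  constructor
  · intro b b' l
    simp only [snocVec, h.add_coeff, tens_add_coeff]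
    abel
  · intro c b l
    simp only [snocVec, h.smul_coeff, tens_smul_coeff, smul_add]
  · intro b l j x y l'
    simp only [snocVec, h.add_entry]
    simp only [List.reverse_cons, List.reverse_reverse, List.append_assoc, List.cons_append,
      tens_add]
    abel
  · intro b l i x c j y l'
    simp only [snocVec, h.balance]
    simp only [List.reverse_cons, List.reverse_reverse, List.append_assoc, List.cons_append,
      tens_balance]
  · intro b c j x l
    have h' := tens_balance_coeff b c j x (l ++ [⟨k, v.2⟩])
    simp only [snocVec, h.balance_coeff]
    simp only [List.reverse_cons, List.reverse_append, List.reverse_reverse, List.reverse_nil,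
      List.nil_append, List.cons_append, h']

lemma rightAct_compatible (k : K) (T : rightOperators (X k)) :
    Compatible (X := X)
      (fun b l => snocVec k (T.1 (split X k l.reverse).1) b (split X k l.reverse).2) := by
  have hT : ∀ (c : B) (x : (X k).carrier), T.1 (0, c • x) = c • T.1 (0, x) := by
    intro c x
    rw [← rightOperators_smul]
    simp
  constructor
  · intro b b' l
    have h := (snocVec_compatible k (T.1 (split X k l.reverse).1)).add_coeff b b'
      (split X k l.reverse).2.reverse
    simpa using h
  · intro c b l
    have h := (snocVec_compatible k (T.1 (split X k l.reverse).1)).smul_coeff c b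
      (split X k l.reverse).2.reverse
    simpa using h
  · intro b l j x y l'
    rcases List.eq_nil_or_concat l' with rfl | ⟨l', ⟨i, z⟩, rfl⟩
    · by_cases h : j = k
      · subst h
        simp only [List.concat_eq_append, List.reverse_append, List.reverse_cons,
          List.reverse_nil, List.nil_append, List.append_assoc, List.cons_append, split_self]
        have e : ((0 : B), x + y) = (0, x) + (0, y) := by ext <;> simp
        rw [e, map_add, snocVec_add]
      · have h' := (snocVec_compatible k (T.1 (1, 0))).add_entry b l j x y []
        simp only [List.concat_eq_append, List.reverse_append, List.reverse_cons,
          List.reverse_nil, List.nil_append, List.append_assoc, List.cons_append, split_ne h] at h' ⊢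
        exact h'
    · by_cases h : i = k
      · subst h
        have h' := (snocVec_compatible i (T.1 (0, z))).add_entry b l j x y l'
        simp only [List.concat_eq_append, List.reverse_append, List.reverse_cons,
          List.reverse_nil, List.nil_append, List.append_assoc, List.cons_append, split_self] at h' ⊢
        exact h'
      · have h' := (snocVec_compatible k (T.1 (1, 0))).add_entry b l j x y (l' ++ [⟨i, z⟩])
        simp only [List.concat_eq_append, List.reverse_append, List.reverse_cons,
          List.reverse_nil, List.nil_append, List.append_assoc, List.cons_append, split_ne h] at h' ⊢
        exact h'
  · intro b l j x c m y l'
    rcases List.eq_nil_or_concat l' with rfl | ⟨l', ⟨i, z⟩, rfl⟩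
    · by_cases h : m = k
      · subst h
        simp only [List.concat_eq_append, List.reverse_append, List.reverse_cons,
          List.reverse_nil, List.nil_append, List.append_assoc, List.cons_append, split_self]
        rw [hT, snocVec_balance]
      · have h' := (snocVec_compatible k (T.1 (1, 0))).balance b l j x c m y []
        simp only [List.concat_eq_append, List.reverse_append, List.reverse_cons,
          List.reverse_nil, List.nil_append, List.append_assoc, List.cons_append, split_ne h] at h' ⊢
        exact h'
    · by_cases h : i = k
      · subst h
        have h' := (snocVec_compatible i (T.1 (0, z))).balance b l j x c m y l'
        simp only [List.concat_eq_append, List.reverse_append, List.reverse_cons,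
          List.reverse_nil, List.nil_append, List.append_assoc, List.cons_append, split_self] at h' ⊢
        exact h'
      · have h' := (snocVec_compatible k (T.1 (1, 0))).balance b l j x c m y (l' ++ [⟨i, z⟩])
        simp only [List.concat_eq_append, List.reverse_append, List.reverse_cons,
          List.reverse_nil, List.nil_append, List.append_assoc, List.cons_append, split_ne h] at h' ⊢
        exact h'
  · intro b c j x l
    rcases List.eq_nil_or_concat l with rfl | ⟨l, ⟨i, z⟩, rfl⟩
    · by_cases h : j = k
      · subst h
        simp only [List.concat_eq_append, List.reverse_append, List.reverse_cons,
          List.reverse_nil, List.nil_append, List.append_assoc, List.cons_append, split_self]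
        rw [hT, snocVec_balance_nil]
      · have h' := (snocVec_compatible k (T.1 (1, 0))).balance_coeff b c j x []
        simp only [List.concat_eq_append, List.reverse_append, List.reverse_cons,
          List.reverse_nil, List.nil_append, List.append_assoc, List.cons_append, split_ne h] at h' ⊢
        exact h'
    · by_cases h : i = k
      · subst h
        have h' := (snocVec_compatible i (T.1 (0, z))).balance_coeff b c j x l
        simp only [List.concat_eq_append, List.reverse_append, List.reverse_cons,
          List.reverse_nil, List.nil_append, List.append_assoc, List.cons_append, split_self] at h' ⊢
        exact h'
      · have h' := (snocVec_compatible k (T.1 (1, 0))).balance_coeff b c j x (l ++ [⟨i, z⟩])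
        simp only [List.concat_eq_append, List.reverse_append, List.reverse_cons,
          List.reverse_nil, List.nil_append, List.append_assoc, List.cons_append, split_ne h] at h' ⊢
        exact h'

/-- The right representation `ρ_k : ℒ_r(𝒳_k) → ℒ(𝒳)`, `T ↦ W_k⁻¹ (I ⊗ T) W_k`. -/
def rightAct (k : K) (T : rightOperators (X k)) : Module.End ℂ (FreeProd X) :=
  liftFree (fun b l => snocVec k (T.1 (split X k l.reverse).1) b (split X k l.reverse).2)
    (rightAct_compatible k T)

end FreeProduct

/-! ### Abstract structures -/

/-- A `B`-`B`-non-commutative probability space `(𝒜, E, ε)`. -/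
structure ProbSpace (B : Type u) (A : Type v) [Ring B] [Algebra ℂ B] [Ring A] [Algebra ℂ A] where
  ε : B ⊗[ℂ] Bᵐᵒᵖ →ₐ[ℂ] A
  E : A →ₗ[ℂ] B
  injective_left : Function.Injective fun b : B => ε (b ⊗ₜ[ℂ] 1)
  injective_right : Function.Injective fun b : Bᵐᵒᵖ => ε (1 ⊗ₜ[ℂ] b)
  E_mul : ∀ (b₁ b₂ : B) (T : A), E (ε (b₁ ⊗ₜ[ℂ] MulOpposite.op b₂) * T) = b₁ * E T * b₂
  E_left_eq_right : ∀ (b : B) (T : A),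
    E (T * ε (b ⊗ₜ[ℂ] 1)) = E (T * ε (1 ⊗ₜ[ℂ] MulOpposite.op b))

section Abstract

variable {B : Type u} {A : Type v} [Ring B] [Algebra ℂ B] [Ring A] [Algebra ℂ A]
  (P : ProbSpace B A)

/-- `L_b = ε(b ⊗ 1)`. -/
def ProbSpace.L (b : B) : A := P.ε (b ⊗ₜ[ℂ] 1)

/-- `R_b = ε(1 ⊗ b)`. -/
def ProbSpace.R (b : B) : A := P.ε (1 ⊗ₜ[ℂ] MulOpposite.op b)

/-- The left algebra `𝒜_ℓ`. -/
def ProbSpace.leftAlg : Subalgebra ℂ A := Subalgebra.centralizer ℂ (Set.range P.R)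

/-- The right algebra `𝒜_r`. -/
def ProbSpace.rightAlg : Subalgebra ℂ A := Subalgebra.centralizer ℂ (Set.range P.L)

lemma ProbSpace.L_mem (b : B) : P.L b ∈ P.leftAlg := by
  rw [ProbSpace.leftAlg, Subalgebra.mem_centralizer_iff]
  rintro _ ⟨c, rfl⟩
  simp [ProbSpace.L, ProbSpace.R, ← map_mul]

lemma ProbSpace.R_mem (b : B) : P.R b ∈ P.rightAlg := by
  rw [ProbSpace.rightAlg, Subalgebra.mem_centralizer_iff]
  rintro _ ⟨c, rfl⟩
  simp [ProbSpace.L, ProbSpace.R, ← map_mul]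

/-- A pair of `B`-faces `(C, D)`. -/
structure FacePair where
  left : Subalgebra ℂ A
  right : Subalgebra ℂ A
  L_mem : ∀ b, P.L b ∈ left
  R_mem : ∀ b, P.R b ∈ right
  left_le : left ≤ P.leftAlg
  right_le : right ≤ P.rightAlg

variable {P}

/-- The letters of `B`-valued moments of a pair of `B`-faces `(C, D)`: elements of `C`, elements
of `D`, and the coefficients `L_b` and `R_b`. -/
inductive Letter (F : FacePair P) : Type (max u v)
  | left (c : F.left)
  | right (d : F.right)
  | coeffL (b : B)
  | coeffR (b : B)

/-- The value of a letter in `𝒜`. -/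
def Letter.eval {F : FacePair P} : Letter F → A
  | .left c => c
  | .right d => d
  | .coeffL b => P.L b
  | .coeffR b => P.R b

/-- The value of a letter of the `k`-th pair of `B`-faces as an operator on the free product of
the bimodules `𝒳_k`, for representations `l_k` and `r_k` on them. -/
def modelEval {K : Type*} {F : K → FacePair P} (X : K → BBimodule.{u, w} B)
    (l : ∀ k, (F k).left →ₐ[ℂ] leftOperators (X k))
    (r : ∀ k, (F k).right →ₐ[ℂ] rightOperators (X k)) :
    (Σ k, Letter (F k)) → Module.End ℂ (FreeProd X)
  | ⟨k, .left c⟩ => leftAct k (l k c)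
  | ⟨k, .right d⟩ => rightAct k (r k d)
  | ⟨_, .coeffL b⟩ => freeL X b
  | ⟨_, .coeffR b⟩ => freeR X b

/-- A family of pairs of `B`-faces is bi-free with amalgamation over `B`: its `B`-valued joint
distribution is that of its images under `λ_k ∘ l_k`, `ρ_k ∘ r_k` on a free product. -/
def IsBiFree {K : Type*} (F : K → FacePair P) : Prop :=
  ∃ (X : K → BBimodule.{u, max u v} B)
    (l : ∀ k, (F k).left →ₐ[ℂ] leftOperators (X k))
    (r : ∀ k, (F k).right →ₐ[ℂ] rightOperators (X k)),
    ∀ m : List (Σ k, Letter (F k)),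
      P.E (m.map fun a => a.2.eval).prod = freeExpectation X (m.map (modelEval X l r)).prod

/-! ### Haar bi-unitaries -/

/-- The letters `U_ℓ, U_ℓ⁻¹, U_r, U_r⁻¹`. -/
inductive HaarLetter
  | left | leftInv | right | rightInv

/-- The bimodule `ℓ²(ℤ, B)` for an algebra `B`, as the finitely supported families `(b_k)`. -/
abbrev HaarModule (B : Type u) [Ring B] : Type u := ℤ →₀ B

/-- The concrete Haar bi-unitary `(b_k)_k ↦ (b_{k+1})_k`. -/
def haarShift (B : Type u) [Ring B] [Algebra ℂ B] : HaarModule B ≃ₗ[ℂ] HaarModule B :=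
  Finsupp.domLCongr (Equiv.subRight (1 : ℤ))

lemma haarShift_apply (f : HaarModule B) (k : ℤ) : haarShift B f k = f (k + 1) := by
  simp [haarShift, Finsupp.equivMapDomain_apply]

/-- Each letter of the concrete Haar bi-unitary; both faces act by the shift. -/
def HaarLetter.concrete (B : Type u) [Ring B] [Algebra ℂ B] :
    HaarLetter → Module.End ℂ (HaarModule B)
  | .left => (haarShift B).toLinearMap
  | .leftInv => (haarShift B).symm.toLinearMap
  | .right => (haarShift B).toLinearMap
  | .rightInv => (haarShift B).symm.toLinearMap

/-- The coefficient operator `C_b` on `ℓ²(ℤ, B)`: `L_b` after a left letter, `R_b` after a right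
letter. -/
def HaarLetter.concreteCoeff (b : B) : HaarLetter → Module.End ℂ (HaarModule B)
  | .left | .leftInv => opL (HaarModule B) b
  | .right | .rightInv => opR (HaarModule B) b

/-- The expectation on the operators of `ℓ²(ℤ, B) = B δ₀ ⊕ (B δ₀)^⊥`. -/
def haarExpectation (T : Module.End ℂ (HaarModule B)) : B := T (Finsupp.single 0 1) 0

variable (P)

/-- Each letter for a pair of invertible elements of `𝒜`. -/
def HaarLetter.eval (Uₗ Uᵣ : Aˣ) : HaarLetter → A
  | .left => (Uₗ : A)
  | .leftInv => ((Uₗ⁻¹ : Aˣ) : A)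
  | .right => (Uᵣ : A)
  | .rightInv => ((Uᵣ⁻¹ : Aˣ) : A)

/-- The coefficient `C_b` in `𝒜`: `L_b` after a left letter, `R_b` after a right letter. -/
def HaarLetter.coeff (b : B) : HaarLetter → A
  | .left | .leftInv => P.L b
  | .right | .rightInv => P.R b

/-- A `B`-valued Haar bi-unitary: invertible `U_ℓ ∈ 𝒜_ℓ` and `U_r ∈ 𝒜_r` such that the moment
series `E(z₁ C_{b₁} z₂ C_{b₂} ⋯ z_{n-1} C_{b_{n-1}} z_n)` is that of the concrete one. -/
structure IsHaarBiUnitary (Uₗ Uᵣ : Aˣ) : Prop where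
  left_mem : (Uₗ : A) ∈ P.leftAlg
  right_mem : (Uᵣ : A) ∈ P.rightAlg
  moments : ∀ (m : List (HaarLetter × B)) (z : HaarLetter),
    P.E ((m.map fun a => a.1.eval Uₗ Uᵣ * a.1.coeff P a.2).prod * z.eval Uₗ Uᵣ) =
      haarExpectation
        ((m.map fun a => a.1.concrete B * a.1.concreteCoeff a.2).prod * z.concrete B)

variable {P}

lemma inv_mem_centralizer {s : Set A} {U : Aˣ} (h : (U : A) ∈ Subalgebra.centralizer ℂ s) :
    ((U⁻¹ : Aˣ) : A) ∈ Subalgebra.centralizer ℂ s := by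
  rw [Subalgebra.mem_centralizer_iff] at h ⊢
  intro g hg
  have h' : Commute g (U : A) := h g hg
  exact h'.units_inv_right

/-- The pair of `B`-faces generated by `(U_ℓ, U_r)`. -/
def generatedPair {Uₗ Uᵣ : Aˣ} (hU : IsHaarBiUnitary P Uₗ Uᵣ) : FacePair P where
  left := Algebra.adjoin ℂ (Set.range P.L ∪ {(Uₗ : A), ((Uₗ⁻¹ : Aˣ) : A)})
  right := Algebra.adjoin ℂ (Set.range P.R ∪ {(Uᵣ : A), ((Uᵣ⁻¹ : Aˣ) : A)})
  L_mem b := Algebra.subset_adjoin (Or.inl ⟨b, rfl⟩)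
  R_mem b := Algebra.subset_adjoin (Or.inl ⟨b, rfl⟩)
  left_le := by
    refine Algebra.adjoin_le ?_
    rintro _ (⟨b, rfl⟩ | rfl | rfl)
    · exact P.L_mem b
    · exact hU.left_mem
    · exact inv_mem_centralizer hU.left_mem
  right_le := by
    refine Algebra.adjoin_le ?_
    rintro _ (⟨b, rfl⟩ | rfl | rfl)
    · exact P.R_mem b
    · exact hU.right_mem
    · exact inv_mem_centralizer hU.right_mem

/-- The pair of `B`-faces `(U_ℓ⁻¹ C U_ℓ, U_r D U_r⁻¹)`. As `U_ℓ` need not commute with the `L_b`,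
nor `U_r` with the `R_b`, this is the smallest pair of `B`-faces that contains the conjugates. -/
def conjugatePair (F : FacePair P) {Uₗ Uᵣ : Aˣ} (hU : IsHaarBiUnitary P Uₗ Uᵣ) : FacePair P where
  left := Algebra.adjoin ℂ
    (Set.range P.L ∪ (fun c : A => ((Uₗ⁻¹ : Aˣ) : A) * c * (Uₗ : A)) '' (F.left : Set A))
  right := Algebra.adjoin ℂ
    (Set.range P.R ∪ (fun d : A => (Uᵣ : A) * d * ((Uᵣ⁻¹ : Aˣ) : A)) '' (F.right : Set A))
  L_mem b := Algebra.subset_adjoin (Or.inl ⟨b, rfl⟩)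
  R_mem b := Algebra.subset_adjoin (Or.inl ⟨b, rfl⟩)
  left_le := by
    refine Algebra.adjoin_le ?_
    rintro _ (⟨b, rfl⟩ | ⟨c, hc, rfl⟩)
    · exact P.L_mem b
    · exact mul_mem (mul_mem (inv_mem_centralizer hU.left_mem) (F.left_le hc)) hU.left_mem
  right_le := by
    refine Algebra.adjoin_le ?_
    rintro _ (⟨b, rfl⟩ | ⟨d, hd, rfl⟩)
    · exact P.R_mem b
    · exact mul_mem (mul_mem hU.right_mem (F.right_le hd)) (inv_mem_centralizer hU.right_mem)

/-- The letter of the conjugated pair that corresponds to a letter of `(C, D)`: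
`c ↦ U_ℓ⁻¹ c U_ℓ`, `d ↦ U_r d U_r⁻¹`, `L_b ↦ L_b`, `R_b ↦ R_b`. -/
def Letter.conjEval {F : FacePair P} (Uₗ Uᵣ : Aˣ) : Letter F → A
  | .left c => ((Uₗ⁻¹ : Aˣ) : A) * c * (Uₗ : A)
  | .right d => (Uᵣ : A) * d * ((Uᵣ⁻¹ : Aˣ) : A)
  | .coeffL b => P.L b
  | .coeffR b => P.R b

end Abstract

end BiFree

end

/-! The joint moments of bi-free pairs depend only on the moments of each pair. So the second factor
of the given model may be replaced by ℓ²(ℤ, B), where the same shift `U`, with `U δ_n = δ_{n-1}`,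
serves for `U_ℓ` on the left and for `U_r` on the right. Put δ₊ = δ₁ and δ₋ = δ₋₁.

Take the free product of two copies of 𝒳₀ and replace each entry `x` of the second copy by `δ₊ ⊗ x ⊗
δ₋`. This lands in the free product of 𝒳₀ and ℓ²(ℤ, B) and turns `λ₁(c)` into `U⁻¹ λ₀(c) U`. On a
word that starts with an entry of the second copy, `U` removes δ₊ and uncovers `x`; on any other
word it creates δ₋ in front. In both cases `λ₀(c)` acts on an 𝒳₀-slot that stands before δ₋, and
`U⁻¹` then absorbs δ₋ into the scalar part and puts δ₊ before the rest. At the right end δ₊ and δ₋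
change places, so `U` and `U⁻¹` do too: the same replacement turns `ρ₁(d)` into `U ρ₀(d) U⁻¹`. This
is why the two faces are conjugated in opposite directions. The operators of the first copy and the
coefficients are unaffected. Hence `(C, D)` and its conjugate behave like two free copies of `(C,
D)`, which gives bi-freeness and equality of distributions. The core is
`PointedShift.preserves_leftAct_one` and `PointedShift.preserves_rightAct_one`.

Two models are always compared through a linear relation: a span of pairs of vectors that contains
the pair of vacuum vectors, is preserved by the paired operators, and lies where the two vector
states agree. No map between the spaces has to be well defined. `PointedRel.freeExpectation_eq` does
this for a change of factors and `PointedShift.freeExpectation_eq` for the replacement above.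

Two points remain. The definition of a Haar bi-unitary fixes only moments with one type of
coefficient after each letter; `IsHaarBiUnitary.moment_eq` extends this to all words. And
bi-freeness asks for representations of the whole algebras `C'` and `D'`, for which 𝒳₀ offers only
the images of generators. These algebras are represented instead on the quotient of 𝒜 by the left
ideal generated by all `L_b - R_b`, and `HaarModel.finalPair_mem` passes from generators to all
elements. -/

noncomputable section

namespace BiFree

/-! ### Alternating words and the operators `leftAct` and `rightAct` on them -/

section Words

variable {B : Type u} [Ring B] [Algebra ℂ B] {K : Type*} {X : K → BBimodule.{u, w} B}

/-- The word `l` is alternating, and its first index (if any) is not `k`. -/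
def Word.Fresh (k : K) (l : Word X) : Prop := (k :: l.map Sigma.fst).IsChain (· ≠ ·)

lemma Word.Fresh.alternating {k : K} {l : Word X} (h : Word.Fresh k l) : Word.Alternating l :=
  List.IsChain.of_cons h

lemma Word.Fresh.cons {k : K} {l : Word X} (h : Word.Fresh k l) (x : (X k).carrier) :
    Word.Alternating (⟨k, x⟩ :: l) := h

/-- The two cases of `split`: all computations with `leftAct k` and `rightAct k` branch here. -/
lemma Word.Alternating.cases {l : Word X} (h : Word.Alternating l) (k : K) :
    Word.Fresh k l ∨ ∃ x l', l = ⟨k, x⟩ :: l' ∧ Word.Fresh k l' := by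
  rcases l with _ | ⟨⟨j, x⟩, l⟩
  · exact Or.inl (List.isChain_singleton k)
  · by_cases hj : j = k
    · subst hj
      exact Or.inr ⟨x, l, rfl, h⟩
    · exact Or.inl (List.isChain_cons_cons.2 ⟨fun e => hj e.symm, h⟩)

lemma Word.fresh_nil (k : K) : Word.Fresh k ([] : Word X) := List.isChain_singleton k

lemma Word.fresh_cons {k j : K} {x : (X j).carrier} {l : Word X} :
    Word.Fresh k (⟨j, x⟩ :: l) ↔ k ≠ j ∧ Word.Fresh j l :=
  List.isChain_cons_cons

lemma Word.alternating_reverse {l : Word X} :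
    Word.Alternating l.reverse ↔ Word.Alternating l := by
  unfold Word.Alternating
  rw [List.map_reverse, List.isChain_reverse]
  constructor <;> exact fun h => h.imp fun _ _ => Ne.symm

lemma tens_eq_zero_of_not_alternating (b : B) {l : Word X} (h : ¬ Word.Alternating l) :
    tens X b l = 0 := by
  unfold Word.Alternating at h
  rw [List.isChain_map, List.isChain_iff_forall_rel_of_append_cons_cons] at h
  push Not at h
  obtain ⟨⟨k, x⟩, ⟨j, y⟩, l₁, l₂, rfl, h⟩ := h
  obtain rfl : k = j := h
  exact tens_repeated b l₁ k x y l₂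

lemma tens_zero_coeff (l : Word X) : tens X 0 l = 0 := by
  simpa using tens_smul_coeff (X := X) 0 0 l

lemma tens_zero_entry (b : B) (l : Word X) (k : K) (l' : Word X) :
    tens X b (l ++ ⟨k, 0⟩ :: l') = 0 := by
  simpa using tens_smul b l k 0 0 l'

/-- The free product is spanned by the alternating words. -/
lemma freeProd_induction {p : FreeProd X → Prop} (zero : p 0)
    (tens' : ∀ b (l : Word X), Word.Alternating l → p (tens X b l))
    (add : ∀ v v', p v → p v' → p (v + v')) (v : FreeProd X) : p v := by
  obtain ⟨f, rfl⟩ := Submodule.Quotient.mk_surjective _ v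
  induction f using Finsupp.induction_linear with
  | zero => exact zero
  | add f g hf hg => exact add _ _ hf hg
  | single a c =>
    have h : (Submodule.Quotient.mk (Finsupp.single a c) : FreeProd X) = tens X (c • a.1) a.2 := by
      rw [tens_smul_coeff, tens, ← Submodule.Quotient.mk_smul, Finsupp.smul_single, smul_eq_mul,
        mul_one]
    rw [h]
    by_cases ha : Word.Alternating a.2
    · exact tens' _ _ ha
    · rw [tens_eq_zero_of_not_alternating _ ha]
      exact zero

lemma freeProd_hom_ext {Y : Type*} [AddCommGroup Y] [Module ℂ Y] {f g : FreeProd X →ₗ[ℂ] Y}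
    (h : ∀ b (l : Word X), Word.Alternating l → f (tens X b l) = g (tens X b l)) : f = g := by
  refine LinearMap.ext fun v => ?_
  exact freeProd_induction (p := fun v => f v = g v) (by simp) h
    (fun v v' hv hv' => by rw [map_add, map_add, hv, hv']) v

/-- The right actions are defined on words read from the right, so their identities are checked on
reversed words. -/
lemma freeProd_hom_ext_reverse {Y : Type*} [AddCommGroup Y] [Module ℂ Y]
    {f g : FreeProd X →ₗ[ℂ] Y}
    (h : ∀ b (m : Word X), Word.Alternating m → f (tens X b m.reverse) = g (tens X b m.reverse)) :
    f = g :=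
  freeProd_hom_ext fun b l hl => by
    simpa using h b l.reverse (Word.alternating_reverse.2 hl)

lemma vectorState_nil (b : B) : vectorState X (tens X b []) = b :=
  liftFree_tens _ _ _ _ List.isChain_nil

lemma vectorState_cons (b : B) (a : Σ k, (X k).carrier) (l : Word X) :
    vectorState X (tens X b (a :: l)) = 0 := by
  by_cases h : Word.Alternating (a :: l)
  · exact liftFree_tens _ _ _ _ h
  · rw [tens_eq_zero_of_not_alternating b h, map_zero]

lemma freeL_tens (c b : B) (l : Word X) : freeL X c (tens X b l) = tens X (c * b) l := by
  by_cases h : Word.Alternating l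
  · exact liftFree_tens _ _ _ _ h
  · rw [tens_eq_zero_of_not_alternating _ h, tens_eq_zero_of_not_alternating _ h, map_zero]

lemma freeR_tens_reverse (c b : B) {m : Word X} (h : Word.Alternating m) :
    freeR X c (tens X b m.reverse) = rightMul c b m := by
  rw [freeR, liftFree_tens _ _ _ _ (Word.alternating_reverse.2 h), List.reverse_reverse]

lemma split_of_fresh {k : K} {l : Word X} (h : Word.Fresh k l) : split X k l = ((1, 0), l) := by
  rcases l with _ | ⟨⟨j, x⟩, l⟩
  · rfl
  · exact split_ne (Ne.symm (Word.fresh_cons.1 h).1) x l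

lemma leftAct_of_fresh {k : K} {l : Word X} (h : Word.Fresh k l) (T : leftOperators (X k))
    (b : B) : leftAct k T (tens X b l) = consVec k (T.1 (b, 0)) l := by
  rw [leftAct, liftFree_tens _ _ _ _ h.alternating, split_of_fresh h]
  simp

lemma leftAct_cons {k : K} {l : Word X} (h : Word.Fresh k l) (T : leftOperators (X k))
    (b : B) (x : (X k).carrier) :
    leftAct k T (tens X b (⟨k, x⟩ :: l)) = consVec k (T.1 (0, b • x)) l := by
  rw [leftAct, liftFree_tens _ _ _ _ (h.cons x), split_self]
  simp

lemma rightAct_of_fresh {k : K} {m : Word X} (h : Word.Fresh k m) (T : rightOperators (X k))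
    (b : B) : rightAct k T (tens X b m.reverse) = snocVec k (T.1 (1, 0)) b m := by
  rw [rightAct, liftFree_tens _ _ _ _ (Word.alternating_reverse.2 h.alternating),
    List.reverse_reverse, split_of_fresh h]

lemma rightAct_cons {k : K} {m : Word X} (h : Word.Fresh k m) (T : rightOperators (X k))
    (b : B) (x : (X k).carrier) :
    rightAct k T (tens X b (⟨k, x⟩ :: m).reverse) = snocVec k (T.1 (0, x)) b m := by
  rw [rightAct, liftFree_tens _ _ _ _ (Word.alternating_reverse.2 (h.cons x)),
    List.reverse_reverse, split_self]

lemma rightMul_one (b : B) (m : Word X) : rightMul 1 b m = tens X b m.reverse := by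
  rcases m with _ | ⟨⟨k, x⟩, m⟩ <;> simp [rightMul]

lemma rightMul_zero (b : B) (m : Word X) : rightMul 0 b m = 0 := by
  rcases m with _ | ⟨⟨k, x⟩, m⟩ <;> simp [rightMul, tens_zero_coeff, tens_zero_entry]

lemma consVec_zero_right (k : K) (c : B) (l : Word X) : consVec k (c, 0) l = tens X c l := by
  have h := tens_zero_entry (X := X) 1 [] k l
  rw [List.nil_append] at h
  rw [consVec, h, add_zero]

lemma consVec_zero_left (k : K) (x : (X k).carrier) (l : Word X) :
    consVec k (0, x) l = tens X 1 (⟨k, x⟩ :: l) := by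
  rw [consVec, tens_zero_coeff, zero_add]

lemma snocVec_zero_right (k : K) (c b : B) (m : Word X) :
    snocVec k (c, 0) b m = rightMul c b m := by
  simp [snocVec, tens_zero_entry]

lemma snocVec_zero_left (k : K) (x : (X k).carrier) (b : B) (m : Word X) :
    snocVec k (0, x) b m = tens X b (⟨k, x⟩ :: m).reverse := by
  simp [snocVec, rightMul_zero]

/-- The two summands of `consVec k v l` fall under the two cases of `leftAct`, and linearity of `T`
recombines them. The result has the same form with the same fresh tail, so `leftAct` can be
iterated. -/
lemma leftAct_consVec {k : K} {l : Word X} (h : Word.Fresh k l) (T : leftOperators (X k))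
    (v : Pointed (X k)) : leftAct k T (consVec k v l) = consVec k (T.1 v) l := by
  rw [consVec, map_add, leftAct_of_fresh h, leftAct_cons h, ← consVec_add, ← map_add]
  simp

lemma rightAct_snocVec {k : K} {m : Word X} (h : Word.Fresh k m) (T : rightOperators (X k))
    (v : Pointed (X k)) (b : B) :
    rightAct k T (snocVec k v b m) = snocVec k (T.1 v) b m := by
  -- Coefficients are kept at the left end of a word, so at the right end the scalar part `v.1` sits
  -- on the last entry. It is moved back into the slot by balance and through `T` by left
  -- `B`-linearity.
  have hv : v = v.1 • ((1 : B), (0 : (X k).carrier)) + (0, v.2) := by ext <;> simp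
  have h₁ : rightAct k T (rightMul v.1 b m) = snocVec k (v.1 • T.1 (1, 0)) b m := by
    rcases m with _ | ⟨⟨j, x⟩, m⟩
    · have := rightAct_of_fresh (Word.fresh_nil k) T (b * v.1)
      rw [List.reverse_nil] at this
      rw [rightMul, this, snocVec_balance_nil]
    · rw [rightMul, rightAct_of_fresh (m := ⟨j, MulOpposite.op v.1 • x⟩ :: m) h, snocVec_balance]
  rw [snocVec, map_add, h₁, rightAct_cons h]
  conv_rhs => rw [hv, map_add, rightOperators_smul, snocVec_add]

lemma leftAct_mul (k : K) (T S : leftOperators (X k)) :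
    leftAct k (T * S) = leftAct k T * leftAct k S :=
  freeProd_hom_ext fun b l hl => by
    rcases hl.cases k with h | ⟨x, l, rfl, h⟩
    · rw [Module.End.mul_apply, leftAct_of_fresh h, leftAct_of_fresh h, leftAct_consVec h]
      rfl
    · rw [Module.End.mul_apply, leftAct_cons h, leftAct_cons h, leftAct_consVec h]
      rfl

lemma leftAct_add (k : K) (T S : leftOperators (X k)) :
    leftAct k (T + S) = leftAct k T + leftAct k S :=
  freeProd_hom_ext fun b l hl => by
    rw [LinearMap.add_apply]
    rcases hl.cases k with h | ⟨x, l, rfl, h⟩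
    · rw [leftAct_of_fresh h, leftAct_of_fresh h, leftAct_of_fresh h, ← consVec_add]
      rfl
    · rw [leftAct_cons h, leftAct_cons h, leftAct_cons h, ← consVec_add]
      rfl

/-- `λ_k` maps `L_b` to `L_b`. -/
lemma leftAct_eq_freeL (k : K) (T : leftOperators (X k)) (c : B)
    (hT : T.1 = opL (Pointed (X k)) c) : leftAct k T = freeL X c :=
  freeProd_hom_ext fun b l hl => by
    rw [freeL_tens]
    rcases hl.cases k with h | ⟨x, l, rfl, h⟩
    · rw [leftAct_of_fresh h, hT]
      have e : opL (Pointed (X k)) c (b, 0) = (c * b, 0) := by simp [opL]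
      rw [e, consVec_zero_right]
    · rw [leftAct_cons h, hT]
      have e : opL (Pointed (X k)) c (0, b • x) = (0, (c * b) • x) := by simp [opL, mul_smul]
      rw [e, consVec_zero_left, ← tens_balance_coeff, one_mul]

lemma rightAct_mul (k : K) (T S : rightOperators (X k)) :
    rightAct k (T * S) = rightAct k T * rightAct k S :=
  freeProd_hom_ext_reverse fun b m hm => by
    rw [Module.End.mul_apply]
    rcases hm.cases k with h | ⟨x, m, rfl, h⟩
    · rw [rightAct_of_fresh h, rightAct_of_fresh h, rightAct_snocVec h]
      rfl
    · rw [rightAct_cons h, rightAct_cons h, rightAct_snocVec h]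
      rfl

lemma rightAct_add (k : K) (T S : rightOperators (X k)) :
    rightAct k (T + S) = rightAct k T + rightAct k S :=
  freeProd_hom_ext_reverse fun b m hm => by
    rw [LinearMap.add_apply]
    rcases hm.cases k with h | ⟨x, m, rfl, h⟩
    · rw [rightAct_of_fresh h, rightAct_of_fresh h, rightAct_of_fresh h, ← snocVec_add]
      rfl
    · rw [rightAct_cons h, rightAct_cons h, rightAct_cons h, ← snocVec_add]
      rfl

/-- `ρ_k` maps `R_b` to `R_b`. -/
lemma rightAct_eq_freeR (k : K) (T : rightOperators (X k)) (c : B)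
    (hT : T.1 = opR (Pointed (X k)) c) : rightAct k T = freeR X c :=
  freeProd_hom_ext_reverse fun b m hm => by
    rw [freeR_tens_reverse c b hm]
    rcases hm.cases k with h | ⟨x, m, rfl, h⟩
    · have e : opR (Pointed (X k)) c (1, 0) = (c, 0) := by simp [opR]
      rw [rightAct_of_fresh h, hT, e, snocVec_zero_right]
    · have e : opR (Pointed (X k)) c (0, x) = (0, MulOpposite.op c • x) := by simp [opR]
      rw [rightAct_cons h, hT, e, snocVec_zero_left, rightMul]

end Words

/-! ### The inclusion of a factor -/

section Inclusion

variable {B : Type u} [Ring B] [Algebra ℂ B] {K : Type*} {X : K → BBimodule.{u, w} B}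

lemma vectorState_consVec_nil (k : K) (v : Pointed (X k)) :
    vectorState X (consVec k v []) = v.1 := by
  rw [consVec, map_add, vectorState_nil, vectorState_cons, add_zero]

lemma freeL_consVec (k : K) (b : B) (v : Pointed (X k)) (l : Word X) :
    freeL X b (consVec k v l) = consVec k (opL (Pointed (X k)) b v) l := by
  have e : opL (Pointed (X k)) b v = (b * v.1, b • v.2) := rfl
  rw [e, consVec, consVec, map_add, freeL_tens, freeL_tens, mul_one, ← tens_balance_coeff, one_mul]

/-- A vector of a single factor is at once a left slot and a right slot; this lets right operators
act on `consVec k v []`. -/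
lemma consVec_nil (k : K) (v : Pointed (X k)) :
    consVec k v [] = snocVec k v 1 [] := by
  simp [consVec, snocVec, rightMul]

lemma freeR_consVec_nil (k : K) (b : B) (v : Pointed (X k)) :
    freeR X b (consVec k v []) = consVec k (opR (Pointed (X k)) b v) [] := by
  have e : opR (Pointed (X k)) b v = (v.1 * b, MulOpposite.op b • v.2) := rfl
  have h₁ := freeR_tens_reverse (X := X) b v.1 (m := []) List.isChain_nil
  have h₂ := freeR_tens_reverse (X := X) b 1 (m := [⟨k, v.2⟩]) (Word.fresh_nil k)
  simp only [List.reverse_nil, List.reverse_singleton, rightMul] at h₁ h₂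
  rw [e, consVec, consVec, map_add, h₁, h₂]

lemma rightAct_consVec_nil (k : K) (T : rightOperators (X k)) (v : Pointed (X k)) :
    rightAct k T (consVec k v []) = consVec k (T.1 v) [] := by
  rw [consVec_nil, consVec_nil, rightAct_snocVec (Word.fresh_nil k)]

/-- The expectation of a product of operators that restrict to the factor `𝒳_k` is computed there. -/
lemma freeExpectation_prod_of_restrict (k : K) {ι : Type*} (T : ι → Module.End ℂ (FreeProd X))
    (t : ι → Module.End ℂ (Pointed (X k)))
    (h : ∀ i v, T i (consVec k v []) = consVec k (t i v) []) (m : List ι) :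
    freeExpectation X (m.map T).prod = ((m.map t).prod (1, 0)).1 := by
  have key : ∀ v, (m.map T).prod (consVec k v []) = consVec k ((m.map t).prod v) [] := by
    induction m with
    | nil => intro v; rfl
    | cons i m ih =>
      intro v
      rw [List.map_cons, List.map_cons, List.prod_cons, List.prod_cons, Module.End.mul_apply,
        Module.End.mul_apply, ih, h]
  rw [freeExpectation, ← consVec_zero_right k, key, vectorState_consVec_nil]

end Inclusion

/-! ### Linear relations between vector spaces with operators -/

section Preserves

variable {V W : Type*} [AddCommGroup V] [Module ℂ V] [AddCommGroup W] [Module ℂ W]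

/-- The pair of operators `(T, T')` preserves the linear relation `𝓡`. -/
def Preserves (𝓡 : Submodule ℂ (V × W)) (T : Module.End ℂ V) (T' : Module.End ℂ W) : Prop :=
  ∀ v v', (v, v') ∈ 𝓡 → (T v, T' v') ∈ 𝓡

lemma Preserves.mul {𝓡 : Submodule ℂ (V × W)} {T S : Module.End ℂ V} {T' S' : Module.End ℂ W}
    (hT : Preserves 𝓡 T T') (hS : Preserves 𝓡 S S') : Preserves 𝓡 (T * S) (T' * S') :=
  fun v v' h => hT _ _ (hS v v' h)

lemma Preserves.list_prod {𝓡 : Submodule ℂ (V × W)} {ι : Type*} {T : ι → Module.End ℂ V}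
    {T' : ι → Module.End ℂ W} (h : ∀ i, Preserves 𝓡 (T i) (T' i)) (m : List ι) :
    Preserves 𝓡 (m.map T).prod (m.map T').prod := by
  induction m with
  | nil => exact fun v v' h => h
  | cons i m ih =>
    rw [List.map_cons, List.map_cons, List.prod_cons, List.prod_cons]
    exact (h i).mul ih

lemma preserves_span {s : Set (V × W)} {T : Module.End ℂ V} {T' : Module.End ℂ W}
    (h : ∀ v v', (v, v') ∈ s → (T v, T' v') ∈ Submodule.span ℂ s) :
    Preserves (Submodule.span ℂ s) T T' := by
  have hle : Submodule.span ℂ s ≤ (Submodule.span ℂ s).comap (T.prodMap T') :=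
    Submodule.span_le.2 fun q hq => h q.1 q.2 hq
  exact fun v v' hv => hle hv

/-- How a relation yields equal moments: the functionals need to agree only on the generating pairs.
-/
lemma eq_of_mem_span {s : Set (V × W)} {Y : Type*} [AddCommGroup Y] [Module ℂ Y] {f : V →ₗ[ℂ] Y}
    {f' : W →ₗ[ℂ] Y} (h : ∀ v v', (v, v') ∈ s → f v = f' v') {v : V} {v' : W}
    (hv : (v, v') ∈ Submodule.span ℂ s) : f v = f' v' := by
  have hle : Submodule.span ℂ s ≤
      LinearMap.eqLocus (f ∘ₗ LinearMap.fst ℂ V W) (f' ∘ₗ LinearMap.snd ℂ V W) :=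
    Submodule.span_le.2 fun q hq => h q.1 q.2 hq
  exact hle hv

end Preserves

/-! ### Relations between pointed bimodules and the relation they induce on free products -/

variable {B : Type u} [Ring B] [Algebra ℂ B]

/-- A relation between two pointed bimodules: a sub-bimodule of the fibre product of `B ⊕ 𝒳°` and
`B ⊕ 𝒴°` over `B` that contains the pair of the two vectors `1_B`. -/
structure PointedRel (X Y : BBimodule.{u, w} B) where
  rel : Submodule ℂ (Pointed X × Pointed Y)
  fst_eq : ∀ v v', (v, v') ∈ rel → v.1 = v'.1
  one_mem : ((1, 0), (1, 0)) ∈ rel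
  smul_mem : ∀ (b : B) v v', (v, v') ∈ rel → (b • v, b • v') ∈ rel
  op_smul_mem : ∀ (b : B) v v', (v, v') ∈ rel → (MulOpposite.op b • v, MulOpposite.op b • v') ∈ rel

namespace PointedRel

section Basic

variable {X Y : BBimodule.{u, w} B} (R : PointedRel X Y)

/-- The pairs of vectors of `𝒳°` and `𝒴°` in the relation. -/
abbrev Entry : Type _ :=
  {q : X.carrier × Y.carrier // (((0 : B), q.1), ((0 : B), q.2)) ∈ R.rel}

lemma coeff_mem (b : B) : ((b, 0), (b, 0)) ∈ R.rel := by
  simpa using R.smul_mem b _ _ R.one_mem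

/-- Related vectors have the same scalar part by `fst_eq`, so subtracting the related pair of
scalars leaves the components in 𝒳° and 𝒴° related. Relations thereby pass to the entries of words.
-/
lemma snd_mem {v : Pointed X} {v' : Pointed Y} (h : (v, v') ∈ R.rel) :
    (((0 : B), v.2), ((0 : B), v'.2)) ∈ R.rel := by
  have h₁ := R.rel.sub_mem h (R.coeff_mem v.1)
  have h₂ := R.fst_eq _ _ h
  have e : (v, v') - ((v.1, (0 : X.carrier)), (v.1, (0 : Y.carrier))) =
      (((0 : B), v.2), ((0 : B), v'.2)) := by
    ext <;> simp [h₂]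
  rwa [e] at h₁

end Basic

/-- The relation generated by two families of operators with the same moments. -/
def cyclic {X Y : BBimodule.{u, w} B} {S : Type*} (t : S → Module.End ℂ (Pointed X))
    (t' : S → Module.End ℂ (Pointed Y))
    (hL : ∀ b : B, ∃ s, t s = opL (Pointed X) b ∧ t' s = opL (Pointed Y) b)
    (hR : ∀ b : B, ∃ s, t s = opR (Pointed X) b ∧ t' s = opR (Pointed Y) b)
    (hmom : ∀ m : List S, ((m.map t).prod (1, 0)).1 = ((m.map t').prod (1, 0)).1) :
    PointedRel X Y where
  rel := Submodule.span ℂ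
    (Set.range fun m : List S => ((m.map t).prod (1, 0), (m.map t').prod (1, 0)))
  fst_eq v v' := eq_of_mem_span (f := LinearMap.fst ℂ B X.carrier) (f' := LinearMap.fst ℂ B Y.carrier)
    (by rintro _ _ ⟨m, hm⟩; cases hm; exact hmom m)
  one_mem := Submodule.subset_span ⟨[], rfl⟩
  smul_mem b := by
    obtain ⟨s, hs, hs'⟩ := hL b
    have h : Preserves (Submodule.span ℂ (Set.range fun m : List S =>
        ((m.map t).prod ((1, 0) : Pointed X), (m.map t').prod ((1, 0) : Pointed Y)))) (t s) (t' s) :=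
      preserves_span (by
        rintro _ _ ⟨m, hm⟩; cases hm
        -- The generating pairs are the orbit of the vacuum pair, and applying one more letter only
        -- lengthens the word.
        exact Submodule.subset_span ⟨s :: m, rfl⟩)
    rw [hs, hs'] at h
    exact h
  op_smul_mem b := by
    obtain ⟨s, hs, hs'⟩ := hR b
    have h : Preserves (Submodule.span ℂ (Set.range fun m : List S =>
        ((m.map t).prod ((1, 0) : Pointed X), (m.map t').prod ((1, 0) : Pointed Y)))) (t s) (t' s) :=
      preserves_span (by
        rintro _ _ ⟨m, hm⟩; cases hm
        exact Submodule.subset_span ⟨s :: m, rfl⟩)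
    rw [hs, hs'] at h
    exact h

lemma cyclic_preserves {X Y : BBimodule.{u, w} B} {S : Type*} {t : S → Module.End ℂ (Pointed X)}
    {t' : S → Module.End ℂ (Pointed Y)}
    (hL : ∀ b : B, ∃ s, t s = opL (Pointed X) b ∧ t' s = opL (Pointed Y) b)
    (hR : ∀ b : B, ∃ s, t s = opR (Pointed X) b ∧ t' s = opR (Pointed Y) b)
    (hmom : ∀ m : List S, ((m.map t).prod (1, 0)).1 = ((m.map t').prod (1, 0)).1) (s : S) :
    Preserves (cyclic t t' hL hR hmom).rel (t s) (t' s) :=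
  preserves_span (by
    rintro _ _ ⟨m, hm⟩; cases hm
    exact Submodule.subset_span ⟨s :: m, rfl⟩)

section Free

variable {K : Type*} {X Y : K → BBimodule.{u, w} B} (R : ∀ k, PointedRel (X k) (Y k))

/-- The words of related pairs of vectors. -/
abbrev EntryWord : Type _ := List (Σ k, (R k).Entry)

variable {R} in
/-- The word of first components. -/
def fstWord (l : EntryWord R) : Word X := l.map fun a => ⟨a.1, a.2.1.1⟩

variable {R} in
/-- The word of second components. -/
def sndWord (l : EntryWord R) : Word Y := l.map fun a => ⟨a.1, a.2.1.2⟩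

/-- The relation between free products induced by relations between the factors. -/
def free : Submodule ℂ (FreeProd X × FreeProd Y) :=
  Submodule.span ℂ (Set.range fun a : B × EntryWord R =>
    (tens X a.1 (fstWord a.2), tens Y a.1 (sndWord a.2)))

variable {R}

lemma tens_mem_free (b : B) (l : EntryWord R) :
    (tens X b (fstWord l), tens Y b (sndWord l)) ∈ free R :=
  Submodule.subset_span ⟨(b, l), rfl⟩

lemma fstWord_index (l : EntryWord R) :
    (fstWord l).map Sigma.fst = l.map Sigma.fst := by
  simp [fstWord, Function.comp_def]

lemma sndWord_index (l : EntryWord R) :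
    (sndWord l).map Sigma.fst = l.map Sigma.fst := by
  simp [sndWord, Function.comp_def]

lemma alternating_sndWord {l : EntryWord R} :
    Word.Alternating (sndWord l) ↔ Word.Alternating (fstWord l) := by
  unfold Word.Alternating
  rw [sndWord_index, fstWord_index]

lemma fresh_sndWord {k : K} {l : EntryWord R} :
    Word.Fresh k (sndWord l) ↔ Word.Fresh k (fstWord l) := by
  unfold Word.Fresh
  rw [sndWord_index, fstWord_index]

lemma fstWord_reverse (l : EntryWord R) : fstWord l.reverse = (fstWord l).reverse :=
  List.map_reverse

lemma sndWord_reverse (l : EntryWord R) : sndWord l.reverse = (sndWord l).reverse :=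
  List.map_reverse

/-- The two scalar parts coincide by `fst_eq`, so both summands are generating pairs of `free R`. -/
lemma consVec_mem_free {k : K} {v : Pointed (X k)} {v' : Pointed (Y k)}
    (h : (v, v') ∈ (R k).rel) (l : EntryWord R) :
    (consVec k v (fstWord l), consVec k v' (sndWord l)) ∈ free R := by
  have h₁ := tens_mem_free v.1 l
  have h₂ := tens_mem_free 1 (⟨k, ⟨(v.2, v'.2), (R k).snd_mem h⟩⟩ :: l)
  have h₃ := (free R).add_mem h₁ h₂
  rw [consVec, consVec, ← (R k).fst_eq _ _ h]
  exact h₃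

lemma rightMul_mem_free (c b : B) (l : EntryWord R) :
    (rightMul c b (fstWord l), rightMul c b (sndWord l)) ∈ free R := by
  rcases l with _ | ⟨⟨k, ⟨⟨x, x'⟩, hx⟩⟩, l⟩
  · exact tens_mem_free (b * c) []
  · have h := (R k).op_smul_mem c _ _ hx
    simp only [Prod.smul_mk, smul_zero] at h
    have h' := tens_mem_free b
      (⟨k, ⟨(MulOpposite.op c • x, MulOpposite.op c • x'), h⟩⟩ :: l).reverse
    rw [fstWord_reverse, sndWord_reverse] at h'
    exact h'

lemma snocVec_mem_free {k : K} {v : Pointed (X k)} {v' : Pointed (Y k)}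
    (h : (v, v') ∈ (R k).rel) (b : B) (l : EntryWord R) :
    (snocVec k v b (fstWord l), snocVec k v' b (sndWord l)) ∈ free R := by
  have h₁ := rightMul_mem_free v.1 b l
  have h₂ := tens_mem_free b (⟨k, ⟨(v.2, v'.2), (R k).snd_mem h⟩⟩ :: l).reverse
  rw [fstWord_reverse, sndWord_reverse] at h₂
  have h₃ := (free R).add_mem h₁ h₂
  rw [snocVec, snocVec, ← (R k).fst_eq _ _ h]
  exact h₃

lemma preserves_free {T : Module.End ℂ (FreeProd X)} {T' : Module.End ℂ (FreeProd Y)}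
    (h : ∀ b (l : EntryWord R), Word.Alternating (fstWord l) →
      (T (tens X b (fstWord l)), T' (tens Y b (sndWord l))) ∈ free R) :
    Preserves (free R) T T' :=
  preserves_span (by
    rintro _ _ ⟨⟨b, l⟩, hm⟩; cases hm
    by_cases hl : Word.Alternating (fstWord l)
    · exact h b l hl
    -- Both words carry the same indices, so they fail to alternate together and both vectors
    -- vanish.
    · have hl' : ¬ Word.Alternating (sndWord l) := fun h => hl (alternating_sndWord.1 h)
      simp only [tens_eq_zero_of_not_alternating b hl, tens_eq_zero_of_not_alternating b hl',
        map_zero]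
      exact zero_mem _)

lemma preserves_free_reverse {T : Module.End ℂ (FreeProd X)} {T' : Module.End ℂ (FreeProd Y)}
    (h : ∀ b (l : EntryWord R), Word.Alternating (fstWord l) →
      (T (tens X b (fstWord l).reverse), T' (tens Y b (sndWord l).reverse)) ∈ free R) :
    Preserves (free R) T T' :=
  preserves_free fun b l hl => by
    have := h b l.reverse (by rwa [fstWord_reverse, Word.alternating_reverse])
    rwa [fstWord_reverse, sndWord_reverse, List.reverse_reverse, List.reverse_reverse] at this

lemma entryWord_cases {l : EntryWord R} (h : Word.Alternating (fstWord l)) (k : K) :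
    Word.Fresh k (fstWord l) ∨
      ∃ (x : (R k).Entry) (l' : EntryWord R), l = ⟨k, x⟩ :: l' ∧ Word.Fresh k (fstWord l') := by
  rcases l with _ | ⟨⟨j, x⟩, l⟩
  · exact Or.inl (Word.fresh_nil k)
  · by_cases hj : j = k
    · subst hj
      exact Or.inr ⟨x, l, rfl, h⟩
    · exact Or.inl (Word.fresh_cons.2 ⟨fun e => hj e.symm, h⟩)

/-- Only the opened slot changes, and there the hypothesis on the factor applies; the tail stays a
word of related entries. -/
lemma preserves_leftAct (k : K) {T : leftOperators (X k)} {T' : leftOperators (Y k)}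
    (h : Preserves (R k).rel T.1 T'.1) : Preserves (free R) (leftAct k T) (leftAct k T') :=
  preserves_free fun b l hl => by
    rcases entryWord_cases hl k with hf | ⟨x, l, rfl, hf⟩
    · rw [leftAct_of_fresh hf, leftAct_of_fresh (fresh_sndWord.2 hf)]
      exact consVec_mem_free (h _ _ ((R k).coeff_mem b)) l
    · have hx := (R k).smul_mem b _ _ x.2
      simp only [Prod.smul_mk, smul_zero] at hx
      have h' := consVec_mem_free (h _ _ hx) l
      rw [← leftAct_cons hf, ← leftAct_cons (fresh_sndWord.2 hf)] at h'
      exact h'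

lemma preserves_rightAct (k : K) {T : rightOperators (X k)} {T' : rightOperators (Y k)}
    (h : Preserves (R k).rel T.1 T'.1) : Preserves (free R) (rightAct k T) (rightAct k T') :=
  preserves_free_reverse fun b l hl => by
    rcases entryWord_cases hl k with hf | ⟨x, l, rfl, hf⟩
    · rw [rightAct_of_fresh hf, rightAct_of_fresh (fresh_sndWord.2 hf)]
      exact snocVec_mem_free (h _ _ (R k).one_mem) b l
    · have h' := snocVec_mem_free (h _ _ x.2) b l
      rw [← rightAct_cons hf, ← rightAct_cons (fresh_sndWord.2 hf)] at h'
      exact h'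

variable (R)

lemma preserves_freeL (b : B) : Preserves (free R) (freeL X b) (freeL Y b) :=
  preserves_free fun c l _ => by
    rw [freeL_tens, freeL_tens]
    exact tens_mem_free (b * c) l

lemma preserves_freeR (b : B) : Preserves (free R) (freeR X b) (freeR Y b) :=
  preserves_free_reverse fun c l hl => by
    rw [freeR_tens_reverse b c hl, freeR_tens_reverse b c (alternating_sndWord.2 hl)]
    exact rightMul_mem_free b c l

/-- The state sees only the empty word, and paired words have equal length and the same coefficient.
-/
lemma vectorState_eq_of_mem_free {v : FreeProd X} {v' : FreeProd Y} (h : (v, v') ∈ free R) :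
    vectorState X v = vectorState Y v' := by
  refine eq_of_mem_span ?_ h
  rintro _ _ ⟨⟨b, _ | ⟨a, l⟩⟩, hm⟩ <;> cases hm
  · exact (vectorState_nil b).trans (vectorState_nil b).symm
  · exact (vectorState_cons b _ _).trans (vectorState_cons b _ _).symm

/-- Operators paired by the induced relation have the same moments. -/
theorem freeExpectation_eq {ι : Type*} {T : ι → Module.End ℂ (FreeProd X)}
    {T' : ι → Module.End ℂ (FreeProd Y)} (h : ∀ i, Preserves (free R) (T i) (T' i)) (m : List ι) :
    freeExpectation X (m.map T).prod = freeExpectation Y (m.map T').prod :=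
  vectorState_eq_of_mem_free R (Preserves.list_prod h m _ _ (tens_mem_free (R := R) 1 []))

end Free

end PointedRel

/-! ### Conjugation by a shift in a free product -/

section Conjugation

variable {B : Type u} [Ring B] [Algebra ℂ B]

/-- A bilateral shift on a pointed bimodule: an invertible bimodule map `S` such that
`S 1_B = δ₋` and `S⁻¹ 1_B = δ₊` are orthogonal to `B`. -/
structure PointedShift (H : BBimodule.{u, w} B) where
  shiftL : leftOperators H
  invL : leftOperators H
  shiftR : rightOperators H
  invR : rightOperators H
  pos : H.carrier
  neg : H.carrier
  shiftR_eq : shiftR.1 = shiftL.1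
  invR_eq : invR.1 = invL.1
  shift_one : shiftL.1 (1, 0) = (0, neg)
  shift_pos : shiftL.1 (0, pos) = (1, 0)
  inv_one : invL.1 (1, 0) = (0, pos)
  inv_neg : invL.1 (0, neg) = (1, 0)

variable {Y : Fin 2 → BBimodule.{u, w} B} (S : PointedShift (Y 1))

namespace PointedShift

/-- By `shiftR_eq` one operator belongs to both the left and the right algebra, so the shift is also
left `B`-linear. -/
lemma shift_coeff (b : B) : S.shiftL.1 (b, 0) = (0, b • S.neg) := by
  have h := rightOperators_smul S.shiftR (1, 0) b
  rw [S.shiftR_eq, S.shift_one] at h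
  simpa using h

lemma shift_smul_pos (b : B) : S.shiftL.1 (0, b • S.pos) = (b, 0) := by
  have h := rightOperators_smul S.shiftR (0, S.pos) b
  rw [S.shiftR_eq, S.shift_pos] at h
  simpa using h

lemma shift_op_smul_pos (b : B) : S.shiftL.1 (0, MulOpposite.op b • S.pos) = (b, 0) := by
  have h := leftOperators_smul S.shiftL (0, S.pos) b
  rw [S.shift_pos] at h
  simpa using h

lemma inv_smul_neg (b : B) : S.invL.1 (0, b • S.neg) = (b, 0) := by
  have h := rightOperators_smul S.invR (0, S.neg) b
  rw [S.invR_eq, S.inv_neg] at h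
  simpa using h

/-- δ₋ is the image of the central vector `1_B` under a bimodule map, hence central. Coefficients
can therefore be pushed across it. -/
lemma op_smul_neg (b : B) : MulOpposite.op b • S.neg = b • S.neg := by
  have h := leftOperators_smul S.shiftL (1, 0) b
  have e : MulOpposite.op b • ((1 : B), (0 : (Y 1).carrier)) = (b, 0) := by simp
  rw [e, S.shift_coeff, S.shift_one] at h
  exact (congrArg Prod.snd h).symm

/-- Replaces each entry `x` of index `1` by `δ₊ ⊗ x ⊗ δ₋`. -/
def flat : Word (fun _ : Fin 2 => Y 0) → Word Y
  | [] => []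
  | ⟨0, x⟩ :: l => ⟨0, x⟩ :: flat l
  | ⟨1, x⟩ :: l => ⟨1, S.pos⟩ :: ⟨0, x⟩ :: ⟨1, S.neg⟩ :: flat l

lemma flat_append (l l' : Word (fun _ : Fin 2 => Y 0)) :
    S.flat (l ++ l') = S.flat l ++ S.flat l' := by
  induction l with
  | nil => rfl
  | cons a l ih =>
    obtain ⟨k, x⟩ := a
    fin_cases k
    · exact congrArg (_ :: ·) ih
    · exact congrArg (fun z => _ :: _ :: _ :: z) ih

/-- The reversed word of `flat`, as a function of the reversed word. -/
def flatRev (m : Word (fun _ : Fin 2 => Y 0)) : Word Y := (S.flat m.reverse).reverse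

lemma flatRev_reverse (m : Word (fun _ : Fin 2 => Y 0)) :
    (S.flatRev m).reverse = S.flat m.reverse := List.reverse_reverse _

lemma flatRev_cons_zero (x : (Y 0).carrier) (m : Word (fun _ : Fin 2 => Y 0)) :
    S.flatRev (⟨0, x⟩ :: m) = ⟨0, x⟩ :: S.flatRev m := by
  simp [flatRev, flat_append, flat]

lemma flatRev_cons_one (x : (Y 0).carrier) (m : Word (fun _ : Fin 2 => Y 0)) :
    S.flatRev (⟨1, x⟩ :: m) = ⟨1, S.neg⟩ :: ⟨0, x⟩ :: ⟨1, S.pos⟩ :: S.flatRev m := by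
  simp [flatRev, flat_append, flat]

/-- The inserted δ₊ and δ₋ carry index `1` around an entry of index `0`, so a block begins and ends
with the index of the entry it replaces. -/
lemma fresh_flat {k : Fin 2} {l : Word (fun _ : Fin 2 => Y 0)} (h : Word.Fresh k l) :
    Word.Fresh k (S.flat l) := by
  induction l generalizing k with
  | nil => exact Word.fresh_nil k
  | cons a l ih =>
    obtain ⟨j, x⟩ := a
    obtain ⟨hkj, hl⟩ := Word.fresh_cons.1 h
    fin_cases j
    · exact Word.fresh_cons.2 ⟨hkj, ih hl⟩
    · exact Word.fresh_cons.2 ⟨hkj, Word.fresh_cons.2 ⟨by decide,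
        Word.fresh_cons.2 ⟨by decide, ih hl⟩⟩⟩

lemma fresh_flatRev {k : Fin 2} {m : Word (fun _ : Fin 2 => Y 0)} (h : Word.Fresh k m) :
    Word.Fresh k (S.flatRev m) := by
  induction m generalizing k with
  | nil => exact Word.fresh_nil k
  | cons a l ih =>
    obtain ⟨j, x⟩ := a
    obtain ⟨hkj, hl⟩ := Word.fresh_cons.1 h
    fin_cases j
    · exact (S.flatRev_cons_zero x l) ▸ Word.fresh_cons.2 ⟨hkj, ih hl⟩
    · exact (S.flatRev_cons_one x l) ▸ Word.fresh_cons.2 ⟨hkj, Word.fresh_cons.2 ⟨by decide,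
        Word.fresh_cons.2 ⟨by decide, ih hl⟩⟩⟩

/-- The relation between a word and its image under `flat`. -/
def conjRel : Submodule ℂ (FreeProd (fun _ : Fin 2 => Y 0) × FreeProd Y) :=
  Submodule.span ℂ {q | ∃ b l, Word.Alternating l ∧ q = (tens _ b l, tens Y b (S.flat l))}

lemma tens_mem {b : B} {l : Word (fun _ : Fin 2 => Y 0)} (hl : Word.Alternating l) :
    (tens _ b l, tens Y b (S.flat l)) ∈ S.conjRel :=
  Submodule.subset_span ⟨b, l, hl, rfl⟩

lemma tens_reverse_mem {b : B} {m : Word (fun _ : Fin 2 => Y 0)} (hm : Word.Alternating m) :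
    (tens _ b m.reverse, tens Y b (S.flatRev m).reverse) ∈ S.conjRel := by
  rw [flatRev_reverse]
  exact S.tens_mem (Word.alternating_reverse.2 hm)

lemma preserves_conjRel {T : Module.End ℂ (FreeProd (fun _ : Fin 2 => Y 0))}
    {T' : Module.End ℂ (FreeProd Y)}
    (h : ∀ b l, Word.Alternating l → (T (tens _ b l), T' (tens Y b (S.flat l))) ∈ S.conjRel) :
    Preserves S.conjRel T T' :=
  preserves_span (by
    rintro _ _ ⟨b, l, hl, hq⟩; cases hq
    exact h b l hl)

lemma preserves_conjRel_reverse {T : Module.End ℂ (FreeProd (fun _ : Fin 2 => Y 0))}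
    {T' : Module.End ℂ (FreeProd Y)}
    (h : ∀ b m, Word.Alternating m →
      (T (tens _ b m.reverse), T' (tens Y b (S.flatRev m).reverse)) ∈ S.conjRel) :
    Preserves S.conjRel T T' :=
  S.preserves_conjRel fun b l hl => by
    have := h b l.reverse (Word.alternating_reverse.2 hl)
    rwa [flatRev_reverse, List.reverse_reverse] at this

lemma rightMul_mem (c b : B) {m : Word (fun _ : Fin 2 => Y 0)} (hm : Word.Alternating m) :
    (rightMul c b m, rightMul c b (S.flatRev m)) ∈ S.conjRel := by
  rcases m with _ | ⟨⟨k, x⟩, m⟩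
  · exact S.tens_mem hm
  · have hm' : Word.Alternating (X := fun _ : Fin 2 => Y 0)
        (⟨k, MulOpposite.op c • x⟩ :: m) := hm
    have h := S.tens_reverse_mem (b := b) hm'
    match k, x, h with
    | 0, x, h =>
      rw [flatRev_cons_zero] at h ⊢
      exact h
    | 1, x, h =>
      rw [flatRev_cons_one] at h ⊢
      -- In the flattened word `c` first hits δ₋. Centrality of δ₋ and balance move it on to `x`,
      -- where it acts in the original word.
      have e : rightMul c b (⟨1, S.neg⟩ :: ⟨0, x⟩ :: ⟨1, S.pos⟩ :: S.flatRev m) =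
          tens Y b ((⟨1, S.neg⟩ :: ⟨0, MulOpposite.op c • x⟩ :: ⟨1, S.pos⟩ ::
            S.flatRev m : Word Y)).reverse := by
        simp only [rightMul, S.op_smul_neg, List.reverse_cons, List.append_assoc, List.cons_append,
          List.nil_append]
        have := tens_balance (X := Y) b ((S.flatRev m).reverse ++ [⟨1, S.pos⟩]) 0 x c 1 S.neg []
        simpa using this.symm
      rw [e]
      exact h

/-- Slots of index `0` are left untouched by `flat`, so operators of the first copy correspond to
themselves. -/
lemma consVec_zero_mem (v : Pointed (Y 0)) {l : Word (fun _ : Fin 2 => Y 0)}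
    (hl : Word.Fresh 0 l) :
    (consVec (X := fun _ : Fin 2 => Y 0) 0 v l, consVec (X := Y) 0 v (S.flat l)) ∈ S.conjRel :=
  S.conjRel.add_mem (S.tens_mem hl.alternating) (S.tens_mem (hl.cons v.2))

lemma snocVec_zero_mem (v : Pointed (Y 0)) (b : B) {m : Word (fun _ : Fin 2 => Y 0)}
    (hm : Word.Fresh 0 m) :
    (snocVec (X := fun _ : Fin 2 => Y 0) 0 v b m, snocVec (X := Y) 0 v b (S.flatRev m)) ∈
      S.conjRel := by
  have h := S.tens_reverse_mem (b := b) (hm.cons v.2)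
  rw [flatRev_cons_zero] at h
  exact S.conjRel.add_mem (S.rightMul_mem v.1 b hm.alternating) h

lemma preserves_leftAct_zero (T : leftOperators (Y 0)) :
    Preserves S.conjRel (leftAct (X := fun _ : Fin 2 => Y 0) 0 T) (leftAct (X := Y) 0 T) :=
  S.preserves_conjRel fun b l hl => by
    rcases hl.cases 0 with h | ⟨x, l, rfl, h⟩
    · rw [leftAct_of_fresh h, leftAct_of_fresh (S.fresh_flat h)]
      exact S.consVec_zero_mem _ h
    · rw [leftAct_cons h, flat, leftAct_cons (S.fresh_flat h)]
      exact S.consVec_zero_mem _ h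

lemma preserves_rightAct_zero (T : rightOperators (Y 0)) :
    Preserves S.conjRel (rightAct (X := fun _ : Fin 2 => Y 0) 0 T) (rightAct (X := Y) 0 T) :=
  S.preserves_conjRel_reverse fun b m hm => by
    rcases hm.cases 0 with h | ⟨x, m, rfl, h⟩
    · rw [rightAct_of_fresh h, rightAct_of_fresh (S.fresh_flatRev h)]
      exact S.snocVec_zero_mem _ b h
    · rw [rightAct_cons h, flatRev_cons_zero, rightAct_cons (S.fresh_flatRev h)]
      exact S.snocVec_zero_mem _ b h

/-- `U⁻¹ ((c ⊕ z) ⊗ δ₋ ⊗ η) = c · η + δ₊ ⊗ z ⊗ δ₋ ⊗ η`. -/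
lemma inv_consVec_mem (v : Pointed (Y 0)) {l : Word (fun _ : Fin 2 => Y 0)}
    (hl : Word.Fresh 1 l) :
    (consVec (X := fun _ : Fin 2 => Y 0) 1 v l,
      leftAct (X := Y) 1 S.invL (consVec 0 v (⟨1, S.neg⟩ :: S.flat l))) ∈ S.conjRel := by
  have hf := S.fresh_flat hl
  have h₁ : leftAct (X := Y) 1 S.invL (tens Y v.1 (⟨1, S.neg⟩ :: S.flat l)) =
      tens Y v.1 (S.flat l) := by
    rw [leftAct_cons hf, inv_smul_neg, consVec_zero_right]
  -- The part of `v` in 𝒳° shields δ₋ from `U⁻¹`, which therefore creates δ₊ in front and completes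
  -- the block `δ₊ ⊗ z ⊗ δ₋`.
  have hf' : Word.Fresh (1 : Fin 2) ((⟨0, v.2⟩ :: ⟨1, S.neg⟩ :: S.flat l : Word Y)) :=
    Word.fresh_cons.2 ⟨by decide, Word.fresh_cons.2 ⟨by decide, hf⟩⟩
  have h₂ : leftAct (X := Y) 1 S.invL (tens Y 1 (⟨0, v.2⟩ :: ⟨1, S.neg⟩ :: S.flat l)) =
      tens Y 1 (S.flat (⟨1, v.2⟩ :: l)) := by
    rw [leftAct_of_fresh hf', S.inv_one, consVec_zero_left]
    rfl
  have h := S.conjRel.add_mem (S.tens_mem (b := v.1) hl.alternating)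
    (S.tens_mem (b := 1) (hl.cons v.2))
  have e : consVec (X := Y) 0 v (⟨1, S.neg⟩ :: S.flat l) = tens Y v.1 (⟨1, S.neg⟩ :: S.flat l) +
      tens Y 1 (⟨0, v.2⟩ :: ⟨1, S.neg⟩ :: S.flat l) := rfl
  rw [e, map_add, h₁, h₂]
  exact h

/-- The left half of the conjugation argument: `U` always leaves an 𝒳₀-slot standing before `δ₋ ⊗
flat l`, `T` acts in that slot, and `inv_consVec_mem` describes what `U⁻¹` makes of the result. -/
lemma preserves_leftAct_one (T : leftOperators (Y 0)) :
    Preserves S.conjRel (leftAct (X := fun _ : Fin 2 => Y 0) 1 T)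
      (leftAct (X := Y) 1 S.invL * leftAct (X := Y) 0 T * leftAct (X := Y) 1 S.shiftL) :=
  S.preserves_conjRel fun b l hl => by
    rw [Module.End.mul_apply, Module.End.mul_apply]
    rcases hl.cases 1 with h | ⟨x, l, rfl, h⟩
    · have hf := S.fresh_flat h
      have hf' : Word.Fresh (0 : Fin 2) ((⟨1, S.neg⟩ :: S.flat l : Word Y)) :=
        Word.fresh_cons.2 ⟨by decide, hf⟩
      -- `U` creates δ₋, and the 𝒳₀-slot before it is empty, so `T` acts on the scalar `b`.
      rw [leftAct_of_fresh h, leftAct_of_fresh hf, shift_coeff, consVec_zero_left,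
        ← tens_balance_coeff, one_mul, leftAct_of_fresh hf']
      exact S.inv_consVec_mem _ h
    · have hf := S.fresh_flat h
      have hf' : Word.Fresh (0 : Fin 2) ((⟨1, S.neg⟩ :: S.flat l : Word Y)) :=
        Word.fresh_cons.2 ⟨by decide, hf⟩
      have hf'' : Word.Fresh (1 : Fin 2) ((⟨0, x⟩ :: ⟨1, S.neg⟩ :: S.flat l : Word Y)) :=
        Word.fresh_cons.2 ⟨by decide, hf'⟩
      -- `U` turns δ₊ into the scalar `1_B`, and the slot before δ₋ already contains `x`.
      rw [leftAct_cons h, flat, leftAct_cons hf'', shift_smul_pos, consVec_zero_right,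
        leftAct_cons hf']
      exact S.inv_consVec_mem _ h

/-- The right-hand version of `inv_consVec_mem`. -/
lemma shift_snocVec_mem (v : Pointed (Y 0)) (b : B) {m : Word (fun _ : Fin 2 => Y 0)}
    (hm : Word.Fresh 1 m) :
    (snocVec (X := fun _ : Fin 2 => Y 0) 1 v b m,
      rightAct (X := Y) 1 S.shiftR (snocVec 0 v b (⟨1, S.pos⟩ :: S.flatRev m))) ∈ S.conjRel := by
  have hf := S.fresh_flatRev hm
  have h₁ : rightAct (X := Y) 1 S.shiftR (rightMul v.1 b (⟨1, S.pos⟩ :: S.flatRev m)) =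
      rightMul v.1 b (S.flatRev m) := by
    rw [rightMul, rightAct_cons hf, S.shiftR_eq, shift_op_smul_pos, snocVec_zero_right]
  have hf' : Word.Fresh (1 : Fin 2) ((⟨0, v.2⟩ :: ⟨1, S.pos⟩ :: S.flatRev m : Word Y)) :=
    Word.fresh_cons.2 ⟨by decide, Word.fresh_cons.2 ⟨by decide, hf⟩⟩
  have h₂ : rightAct (X := Y) 1 S.shiftR
      (tens Y b (⟨0, v.2⟩ :: ⟨1, S.pos⟩ :: S.flatRev m : Word Y).reverse) =
      tens Y b (S.flatRev (⟨1, v.2⟩ :: m)).reverse := by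
    rw [rightAct_of_fresh hf', S.shiftR_eq, S.shift_one, snocVec_zero_left, flatRev_cons_one]
  have h := S.conjRel.add_mem (S.rightMul_mem v.1 b hm.alternating)
    (S.tens_reverse_mem (b := b) (hm.cons v.2))
  have e : snocVec (X := Y) 0 v b (⟨1, S.pos⟩ :: S.flatRev m) =
      rightMul v.1 b (⟨1, S.pos⟩ :: S.flatRev m) +
        tens Y b (⟨0, v.2⟩ :: ⟨1, S.pos⟩ :: S.flatRev m : Word Y).reverse := rfl
  rw [e, map_add, h₁, h₂]
  exact h

/-- The mirror image of `preserves_leftAct_one`. Seen from the right a block starts with δ₋, which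
`U⁻¹` removes; on a fresh word `U⁻¹` creates δ₊. The slot then stands after δ₊, and `U` absorbs δ₊
or adds δ₋. -/
lemma preserves_rightAct_one (T : rightOperators (Y 0)) :
    Preserves S.conjRel (rightAct (X := fun _ : Fin 2 => Y 0) 1 T)
      (rightAct (X := Y) 1 S.shiftR * rightAct (X := Y) 0 T * rightAct (X := Y) 1 S.invR) :=
  S.preserves_conjRel_reverse fun b m hm => by
    rw [Module.End.mul_apply, Module.End.mul_apply]
    rcases hm.cases 1 with h | ⟨x, m, rfl, h⟩
    · have hf := S.fresh_flatRev h
      have hf' : Word.Fresh (0 : Fin 2) ((⟨1, S.pos⟩ :: S.flatRev m : Word Y)) :=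
        Word.fresh_cons.2 ⟨by decide, hf⟩
      rw [rightAct_of_fresh h, rightAct_of_fresh hf, S.invR_eq, S.inv_one, snocVec_zero_left,
        rightAct_of_fresh hf']
      exact S.shift_snocVec_mem _ b h
    · have hf := S.fresh_flatRev h
      have hf' : Word.Fresh (0 : Fin 2) ((⟨1, S.pos⟩ :: S.flatRev m : Word Y)) :=
        Word.fresh_cons.2 ⟨by decide, hf⟩
      have hf'' : Word.Fresh (1 : Fin 2) ((⟨0, x⟩ :: ⟨1, S.pos⟩ :: S.flatRev m : Word Y)) :=
        Word.fresh_cons.2 ⟨by decide, hf'⟩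
      rw [rightAct_cons h, flatRev_cons_one, rightAct_cons hf'', S.invR_eq, S.inv_neg,
        snocVec_zero_right, rightMul_one, rightAct_cons hf']
      exact S.shift_snocVec_mem _ b h

lemma preserves_freeL (b : B) :
    Preserves S.conjRel (freeL (fun _ : Fin 2 => Y 0) b) (freeL Y b) :=
  S.preserves_conjRel fun c l hl => by
    rw [freeL_tens, freeL_tens]
    exact S.tens_mem hl

lemma preserves_freeR (b : B) :
    Preserves S.conjRel (freeR (fun _ : Fin 2 => Y 0) b) (freeR Y b) :=
  S.preserves_conjRel_reverse fun c m hm => by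
    -- `freeR_tens_reverse` needs alternation; it is obtained from freshness of the flattened tail
    -- after its first block.
    have hm' : Word.Alternating (S.flatRev m) := by
      rcases m with _ | ⟨⟨k, x⟩, m⟩
      · exact List.isChain_nil
      · fin_cases k
        · exact (S.flatRev_cons_zero x m) ▸ S.fresh_flatRev (k := 0) (m := m) hm
        · exact (S.flatRev_cons_one x m) ▸ Word.fresh_cons.2 ⟨one_ne_zero,
            Word.fresh_cons.2 ⟨zero_ne_one, S.fresh_flatRev (k := 1) (m := m) hm⟩⟩
    rw [freeR_tens_reverse b c hm, freeR_tens_reverse b c hm']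
    exact S.rightMul_mem b c hm

/-- Operators paired by `conjRel` have the same moments. -/
theorem freeExpectation_eq {ι : Type*} {T : ι → Module.End ℂ (FreeProd (fun _ : Fin 2 => Y 0))}
    {T' : ι → Module.End ℂ (FreeProd Y)} (h : ∀ i, Preserves S.conjRel (T i) (T' i))
    (m : List ι) :
    freeExpectation (fun _ : Fin 2 => Y 0) (m.map T).prod = freeExpectation Y (m.map T').prod := by
  refine eq_of_mem_span ?_
    (Preserves.list_prod h m _ _ (S.tens_mem (b := 1) (l := []) List.isChain_nil))
  rintro _ _ ⟨b, _ | ⟨⟨k, x⟩, l⟩, -, hq⟩ <;> cases hq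
  · exact (vectorState_nil b).trans (vectorState_nil b).symm
  · rw [vectorState_cons]
    -- A nonempty word has nonempty image under `flat`, so both states are zero.
    fin_cases k <;> exact (vectorState_cons b _ _).symm

end PointedShift

end Conjugation

/-! ### Splitting off the vector state of a bimodule -/

/-- A vector space with commuting left and right actions of `B`, a bimodule map `p` to `B`, and a
central vector `ξ` with `p ξ = 1`. -/
structure StateSpace (B : Type u) [Ring B] [Algebra ℂ B] (V : Type v) [AddCommGroup V]
    [Module ℂ V] where
  actL : B →ₐ[ℂ] Module.End ℂ V
  actR : Bᵐᵒᵖ →ₐ[ℂ] Module.End ℂ V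
  comm : ∀ b c, Commute (actL b) (actR c)
  p : V →ₗ[ℂ] B
  p_actL : ∀ b v, p (actL b v) = b * p v
  p_actR : ∀ b v, p (actR (MulOpposite.op b) v) = p v * b
  ξ : V
  central : ∀ b, actL b ξ = actR (MulOpposite.op b) ξ
  p_ξ : p ξ = 1

namespace StateSpace

variable {B : Type u} [Ring B] [Algebra ℂ B] {V : Type v} [AddCommGroup V] [Module ℂ V]
  (Z : StateSpace B V)

/-- The kernel of the vector state. -/
def Ker : Type max v w := ULift.{w} (LinearMap.ker Z.p)

instance : AddCommGroup Z.Ker := inferInstanceAs (AddCommGroup (ULift (LinearMap.ker Z.p)))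

instance : Module ℂ Z.Ker := inferInstanceAs (Module ℂ (ULift (LinearMap.ker Z.p)))

/-- The inclusion of the kernel of the vector state. -/
def kerSubtype : Z.Ker →ₗ[ℂ] V :=
  (LinearMap.ker Z.p).subtype ∘ₗ (ULift.moduleEquiv (R := ℂ) (M := LinearMap.ker Z.p)).toLinearMap

lemma kerSubtype_injective : Function.Injective Z.kerSubtype :=
  Subtype.val_injective.comp ULift.down_injective

lemma p_kerSubtype (x : Z.Ker) : Z.p (Z.kerSubtype x) = 0 := x.down.2

/-- An element of the kernel of the vector state. -/
def kerMk (v : V) (hv : Z.p v = 0) : Z.Ker := ⟨⟨v, hv⟩⟩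

instance : SMul B Z.Ker :=
  ⟨fun b x => Z.kerMk (Z.actL b (Z.kerSubtype x)) (by rw [p_actL, p_kerSubtype, mul_zero])⟩

instance : SMul Bᵐᵒᵖ Z.Ker :=
  ⟨fun b x => Z.kerMk (Z.actR b (Z.kerSubtype x)) (by
    have h := Z.p_actR b.unop (Z.kerSubtype x)
    rwa [MulOpposite.op_unop, p_kerSubtype, zero_mul] at h)⟩

lemma kerSubtype_smul (b : B) (x : Z.Ker) :
    Z.kerSubtype (b • x) = Z.actL b (Z.kerSubtype x) := rfl

lemma kerSubtype_op_smul (b : Bᵐᵒᵖ) (x : Z.Ker) :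
    Z.kerSubtype (b • x) = Z.actR b (Z.kerSubtype x) := rfl

instance : Module B Z.Ker where
  one_smul x := Z.kerSubtype_injective (by simp [kerSubtype_smul])
  mul_smul b c x := Z.kerSubtype_injective (by simp [kerSubtype_smul])
  smul_zero b := Z.kerSubtype_injective (by simp [kerSubtype_smul])
  smul_add b x y := Z.kerSubtype_injective (by simp [kerSubtype_smul])
  add_smul b c x := Z.kerSubtype_injective (by simp [kerSubtype_smul])
  zero_smul x := Z.kerSubtype_injective (by simp [kerSubtype_smul])

instance : Module Bᵐᵒᵖ Z.Ker where
  one_smul x := Z.kerSubtype_injective (by simp [kerSubtype_op_smul])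
  mul_smul b c x := Z.kerSubtype_injective (by simp [kerSubtype_op_smul])
  smul_zero b := Z.kerSubtype_injective (by simp [kerSubtype_op_smul])
  smul_add b x y := Z.kerSubtype_injective (by simp [kerSubtype_op_smul])
  add_smul b c x := Z.kerSubtype_injective (by simp [kerSubtype_op_smul])
  zero_smul x := Z.kerSubtype_injective (by simp [kerSubtype_op_smul])

instance : SMulCommClass B Bᵐᵒᵖ Z.Ker :=
  ⟨fun b c x => Z.kerSubtype_injective (LinearMap.congr_fun (Z.comm b c).eq (Z.kerSubtype x))⟩

instance : IsScalarTower ℂ B Z.Ker :=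
  ⟨fun c b x => Z.kerSubtype_injective (by simp [kerSubtype_smul])⟩

instance : IsScalarTower ℂ Bᵐᵒᵖ Z.Ker :=
  ⟨fun c b x => Z.kerSubtype_injective (by simp [kerSubtype_op_smul])⟩

/-- The kernel of the vector state as a bimodule. -/
def kerBimodule : BBimodule.{u, max v w} B where
  carrier := Ker.{u, v, w} Z

/-- The inclusion of `kerBimodule` in `V`. -/
def incl : (kerBimodule.{u, v, w} Z).carrier →ₗ[ℂ] V := Z.kerSubtype

lemma incl_injective : Function.Injective (incl.{u, v, w} Z) := Z.kerSubtype_injective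

lemma p_incl (x : (kerBimodule.{u, v, w} Z).carrier) : Z.p (Z.incl x) = 0 := Z.p_kerSubtype x

lemma incl_smul (b : B) (x : (kerBimodule.{u, v, w} Z).carrier) :
    Z.incl (b • x) = Z.actL b (Z.incl x) := rfl

lemma incl_op_smul (b : Bᵐᵒᵖ) (x : (kerBimodule.{u, v, w} Z).carrier) :
    Z.incl (b • x) = Z.actR b (Z.incl x) := rfl

lemma exists_incl_eq {v : V} (hv : Z.p v = 0) :
    ∃ x : (kerBimodule.{u, v, w} Z).carrier, Z.incl x = v := ⟨Z.kerMk v hv, rfl⟩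

/-- The map `(b, x) ↦ b ξ + x`. -/
def join : Pointed (kerBimodule.{u, v, w} Z) →ₗ[ℂ] V where
  toFun q := Z.actL q.1 Z.ξ + Z.incl q.2
  map_add' q q' := by
    simp only [Prod.fst_add, Prod.snd_add, map_add, LinearMap.add_apply]
    abel
  map_smul' c q := by simp

lemma join_apply (q : Pointed (kerBimodule.{u, v, w} Z)) :
    Z.join q = Z.actL q.1 Z.ξ + Z.incl q.2 := rfl

lemma p_join (q : Pointed (kerBimodule.{u, v, w} Z)) : Z.p (Z.join q) = q.1 := by
  rw [join_apply, map_add, p_actL, p_ξ, p_incl, mul_one, add_zero]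

/-- The inverse is `v ↦ (p v, v - p(v) ξ)`, and injectivity follows by applying `p`. -/
lemma join_bijective : Function.Bijective (join.{u, v, w} Z) := by
  constructor
  · intro q q' h
    have h₁ : q.1 = q'.1 := by rw [← p_join, h, p_join]
    rw [join_apply, join_apply, h₁] at h
    exact Prod.ext h₁ (Z.incl_injective (add_left_cancel h))
  · intro v
    obtain ⟨x, hx⟩ := exists_incl_eq.{u, v, w} Z (v := v - Z.actL (Z.p v) Z.ξ)
      (by rw [map_sub, p_actL, p_ξ, mul_one, sub_self])
    exact ⟨(Z.p v, x), by rw [join_apply, hx, add_sub_cancel]⟩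

/-- The decomposition `B ⊕ ker p = V`. -/
def joinEquiv : Pointed (kerBimodule.{u, v, w} Z) ≃ₗ[ℂ] V :=
  LinearEquiv.ofBijective Z.join Z.join_bijective

/-- Operators on `V` as operators on `B ⊕ ker p`. -/
def transport : Module.End ℂ V →ₐ[ℂ] Module.End ℂ (Pointed (kerBimodule.{u, v, w} Z)) :=
  ((joinEquiv.{u, v, w} Z).symm.conjAlgEquiv ℂ).toAlgHom

lemma join_transport (T : Module.End ℂ V) (q : Pointed (kerBimodule.{u, v, w} Z)) :
    Z.join (transport.{u, v, w} Z T q) = T (Z.join q) :=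
  (joinEquiv.{u, v, w} Z).apply_symm_apply _

lemma transport_eq_iff {T : Module.End ℂ V} {q q' : Pointed (kerBimodule.{u, v, w} Z)} :
    transport.{u, v, w} Z T q = q' ↔ T (Z.join q) = Z.join q' := by
  rw [← join_transport]
  exact Z.join_bijective.1.eq_iff.symm

lemma join_one : Z.join ((1, 0) : Pointed (kerBimodule.{u, v, w} Z)) = Z.ξ := by
  rw [join_apply, map_one, map_zero, add_zero, Module.End.one_apply]

lemma join_incl (x : (kerBimodule.{u, v, w} Z).carrier) :
    Z.join (((0 : B), x) : Pointed (kerBimodule.{u, v, w} Z)) = Z.incl x := by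
  rw [join_apply, map_zero, LinearMap.zero_apply, zero_add]

lemma transport_one_fst (T : Module.End ℂ V) :
    (transport.{u, v, w} Z T (1, 0)).1 = Z.p (T Z.ξ) := by
  rw [← p_join, join_transport, join_one]

lemma transport_one_eq {T : Module.End ℂ V} {x : (kerBimodule.{u, v, w} Z).carrier}
    (h : T Z.ξ = Z.incl x) : transport.{u, v, w} Z T (1, 0) = (0, x) :=
  Z.transport_eq_iff.2 (by rw [join_one, join_incl, h])

lemma transport_eq_one {T : Module.End ℂ V} {x : (kerBimodule.{u, v, w} Z).carrier}
    (h : T (Z.incl x) = Z.ξ) : transport.{u, v, w} Z T (0, x) = (1, 0) :=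
  Z.transport_eq_iff.2 (by rw [join_one, join_incl, h])

lemma transport_actL (b : B) :
    transport.{u, v, w} Z (Z.actL b) = opL (Pointed (kerBimodule.{u, v, w} Z)) b := by
  refine LinearMap.ext fun q => Z.transport_eq_iff.2 ?_
  have e : opL (Pointed (kerBimodule.{u, v, w} Z)) b q = (b * q.1, b • q.2) := rfl
  rw [e, join_apply, join_apply, map_add, incl_smul, map_mul, Module.End.mul_apply]

lemma transport_actR (b : B) :
    transport.{u, v, w} Z (Z.actR (MulOpposite.op b)) =
      opR (Pointed (kerBimodule.{u, v, w} Z)) b := by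
  refine LinearMap.ext fun q => Z.transport_eq_iff.2 ?_
  have e : opR (Pointed (kerBimodule.{u, v, w} Z)) b q = (q.1 * b, MulOpposite.op b • q.2) := rfl
  -- On the summand `B ξ`, centrality of `ξ` turns the right action of `b` into a left action, which
  -- gives the scalar `q.1 * b`.
  have h := LinearMap.congr_fun (Z.comm q.1 (MulOpposite.op b)).eq Z.ξ
  rw [Module.End.mul_apply, Module.End.mul_apply] at h
  rw [e, join_apply, join_apply, map_add, incl_op_smul, map_mul, Module.End.mul_apply, central Z b, h]

lemma transport_mem_leftOperators {T : Module.End ℂ V}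
    (hT : ∀ b, Commute (Z.actR b) T) :
    transport.{u, v, w} Z T ∈ leftOperators (kerBimodule.{u, v, w} Z) := by
  rw [leftOperators, Subalgebra.mem_centralizer_iff]
  rintro _ ⟨b, rfl⟩
  rw [← transport_actR, ← map_mul, ← map_mul, (hT _).eq]

lemma transport_mem_rightOperators {T : Module.End ℂ V}
    (hT : ∀ b, Commute (Z.actL b) T) :
    transport.{u, v, w} Z T ∈ rightOperators (kerBimodule.{u, v, w} Z) := by
  rw [rightOperators, Subalgebra.mem_centralizer_iff]
  rintro _ ⟨b, rfl⟩
  rw [← transport_actL, ← map_mul, ← map_mul, (hT _).eq]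

end StateSpace

/-! ### Moments of a Haar bi-unitary -/

section HaarMoments

variable {B : Type u} {A : Type v} [Ring B] [Algebra ℂ B] [Ring A] [Algebra ℂ A]
  {P : ProbSpace B A}

lemma ProbSpace.L_mul_R (a c : B) : P.L a * P.R c = P.ε (a ⊗ₜ[ℂ] MulOpposite.op c) := by
  simp [ProbSpace.L, ProbSpace.R, ← map_mul]

lemma ProbSpace.R_mul_L (a c : B) : P.R c * P.L a = P.ε (a ⊗ₜ[ℂ] MulOpposite.op c) := by
  simp [ProbSpace.L, ProbSpace.R, ← map_mul]

lemma ProbSpace.L_mul (a b : B) : P.L a * P.L b = P.L (a * b) := by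
  simp [ProbSpace.L, ← map_mul]

lemma ProbSpace.R_mul (a b : B) : P.R a * P.R b = P.R (b * a) := by
  simp [ProbSpace.R, ← map_mul]

lemma ProbSpace.L_one : P.L 1 = 1 := by
  simp [ProbSpace.L, ← Algebra.TensorProduct.one_def]

lemma ProbSpace.R_one : P.R 1 = 1 := by
  simp [ProbSpace.R, ← Algebra.TensorProduct.one_def]

lemma ProbSpace.L_algebraMap (P : ProbSpace B A) (z : ℂ) :
    P.L (algebraMap ℂ B z) = algebraMap ℂ A z :=
  (P.ε.comp Algebra.TensorProduct.includeLeft).commutes z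

lemma ProbSpace.R_algebraMap (P : ProbSpace B A) (z : ℂ) :
    P.R (algebraMap ℂ B z) = algebraMap ℂ A z :=
  (P.ε.comp Algebra.TensorProduct.includeRight).commutes z

lemma haarShift_symm_apply (f : HaarModule B) (k : ℤ) :
    (haarShift B).symm f k = f (k - 1) := by
  have h := haarShift_apply ((haarShift B).symm f) (k - 1)
  rwa [LinearEquiv.apply_symm_apply, sub_add_cancel, eq_comm] at h

/-- The shift permutes coordinates and both actions are coordinatewise, so every concrete letter
commutes with both. In 𝒜 a left letter is known to commute only with the `R_b`. -/
lemma HaarLetter.concrete_commute_opL (z : HaarLetter) (b : B) :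
    Commute (z.concrete B) (opL (HaarModule B) b) := by
  refine LinearMap.ext fun f => Finsupp.ext fun k => ?_
  cases z <;>
    simp [HaarLetter.concrete, opL, haarShift_apply, haarShift_symm_apply]

lemma HaarLetter.concrete_commute_opR (z : HaarLetter) (b : B) :
    Commute (z.concrete B) (opR (HaarModule B) b) := by
  refine LinearMap.ext fun f => Finsupp.ext fun k => ?_
  cases z <;>
    simp [HaarLetter.concrete, opR, haarShift_apply, haarShift_symm_apply]

/-- The letters of words in `U_ℓ^{±1}, U_r^{±1}`, `L_b` and `R_b`. -/
inductive HaarSymbol (B : Type u)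
  | unitary (z : HaarLetter)
  | coeffL (b : B)
  | coeffR (b : B)

variable (P)

/-- The value of a symbol in `𝒜` and on `ℓ²(ℤ, B)`. -/
def HaarSymbol.pair (Uₗ Uᵣ : Aˣ) : HaarSymbol B → A × Module.End ℂ (HaarModule B)
  | .unitary z => (z.eval Uₗ Uᵣ, z.concrete B)
  | .coeffL b => (P.L b, opL (HaarModule B) b)
  | .coeffR b => (P.R b, opR (HaarModule B) b)

/-- The value of `z C_b` in `𝒜` and on `ℓ²(ℤ, B)`. -/
def haarBlock (Uₗ Uᵣ : Aˣ) (a : HaarLetter × B) : A × Module.End ℂ (HaarModule B) :=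
  (a.1.eval Uₗ Uᵣ * a.1.coeff P a.2, a.1.concrete B * a.1.concreteCoeff a.2)

/-- A product of the form `L_a R_c z₁ C_{b₁} ⋯ z_n C_{b_n}`. -/
def IsHaarNormal (Uₗ Uᵣ : Aˣ) (q : A × Module.End ℂ (HaarModule B)) : Prop :=
  ∃ (a c : B) (n : List (HaarLetter × B)),
    q = HaarSymbol.pair P Uₗ Uᵣ (.coeffL a) * HaarSymbol.pair P Uₗ Uᵣ (.coeffR c) *
      (n.map (haarBlock P Uₗ Uᵣ)).prod

variable {P} {Uₗ Uᵣ : Aˣ}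

local notation "π" => HaarSymbol.pair P Uₗ Uᵣ

lemma pair_commute_LR (a c : B) : Commute (π (.coeffL a)) (π (.coeffR c)) :=
  Prod.ext (ProbSpace.L_mul_R a c |>.trans (ProbSpace.R_mul_L a c).symm)
    (LinearMap.ext fun f => smul_comm a (MulOpposite.op c) f)

lemma pair_L_mul (a b : B) : π (.coeffL a) * π (.coeffL b) = π (.coeffL (a * b)) :=
  Prod.ext (ProbSpace.L_mul a b) (by simp [HaarSymbol.pair, opL])

lemma pair_R_mul (a b : B) : π (.coeffR a) * π (.coeffR b) = π (.coeffR (b * a)) :=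
  Prod.ext (ProbSpace.R_mul a b) (by simp [HaarSymbol.pair, opR])

lemma pair_L_one : π (.coeffL 1) = 1 :=
  Prod.ext ProbSpace.L_one (by simp [HaarSymbol.pair, opL])

lemma pair_R_one : π (.coeffR 1) = 1 :=
  Prod.ext ProbSpace.R_one (by simp [HaarSymbol.pair, opR])

/-- The left letters of a Haar bi-unitary. -/
def HaarLetter.IsLeft : HaarLetter → Prop
  | .left | .leftInv => True
  | .right | .rightInv => False

lemma pair_unitary_commute_R (hU : IsHaarBiUnitary P Uₗ Uᵣ) {z : HaarLetter} (hz : z.IsLeft)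
    (b : B) : Commute (π (.unitary z)) (π (.coeffR b)) := by
  refine Prod.ext ?_ (z.concrete_commute_opR b)
  have h := (Subalgebra.mem_centralizer_iff ℂ).1 hU.left_mem _ ⟨b, rfl⟩
  have h' := (Subalgebra.mem_centralizer_iff ℂ).1 (inv_mem_centralizer hU.left_mem) _ ⟨b, rfl⟩
  cases z
  · exact h.symm
  · exact h'.symm
  · exact hz.elim
  · exact hz.elim

lemma pair_unitary_commute_L (hU : IsHaarBiUnitary P Uₗ Uᵣ) {z : HaarLetter} (hz : ¬ z.IsLeft)
    (b : B) : Commute (π (.unitary z)) (π (.coeffL b)) := by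
  refine Prod.ext ?_ (z.concrete_commute_opL b)
  have h := (Subalgebra.mem_centralizer_iff ℂ).1 hU.right_mem _ ⟨b, rfl⟩
  have h' := (Subalgebra.mem_centralizer_iff ℂ).1 (inv_mem_centralizer hU.right_mem) _ ⟨b, rfl⟩
  cases z
  · exact (hz trivial).elim
  · exact (hz trivial).elim
  · exact h.symm
  · exact h'.symm

lemma haarBlock_of_isLeft {z : HaarLetter} (hz : z.IsLeft) (b : B) :
    haarBlock P Uₗ Uᵣ (z, b) = π (.unitary z) * π (.coeffL b) := by
  cases z <;> first | rfl | exact hz.elim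

lemma haarBlock_of_not_isLeft {z : HaarLetter} (hz : ¬ z.IsLeft) (b : B) :
    haarBlock P Uₗ Uᵣ (z, b) = π (.unitary z) * π (.coeffR b) := by
  cases z <;> first | rfl | exact (hz trivial).elim

lemma isHaarNormal_one : IsHaarNormal P Uₗ Uᵣ 1 :=
  ⟨1, 1, [], by rw [pair_L_one, pair_R_one]; simp⟩

/-- Normal forms are closed under left multiplication by symbols, so every word has one. Working
with pairs rewrites the word in 𝒜 and its concrete counterpart simultaneously. -/
lemma IsHaarNormal.pair_mul (hU : IsHaarBiUnitary P Uₗ Uᵣ)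
    {q : A × Module.End ℂ (HaarModule B)} (h : IsHaarNormal P Uₗ Uᵣ q) (s : HaarSymbol B) :
    IsHaarNormal P Uₗ Uᵣ (π s * q) := by
  obtain ⟨a, c, n, rfl⟩ := h
  rcases s with z | b | b
  · by_cases hz : z.IsLeft
    -- A left letter passes `R_c`, and `L_a` becomes the coefficient that follows it.
    · refine ⟨1, c, (z, a) :: n, ?_⟩
      rw [List.map_cons, List.prod_cons, haarBlock_of_isLeft hz, pair_L_one, one_mul,
        (pair_commute_LR a c).eq, ← mul_assoc, ← mul_assoc, ← mul_assoc, ← mul_assoc,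
        (pair_unitary_commute_R hU hz c).eq]
    · refine ⟨a, 1, (z, c) :: n, ?_⟩
      -- A right letter passes `L_a`, and `R_c` becomes the coefficient that follows it.
      rw [List.map_cons, List.prod_cons, haarBlock_of_not_isLeft hz, pair_R_one, mul_one,
        ← mul_assoc, ← mul_assoc, ← mul_assoc, ← mul_assoc,
        (pair_unitary_commute_L hU hz a).eq]
  · exact ⟨b * a, c, n, by rw [← mul_assoc, ← mul_assoc, pair_L_mul]⟩
  · exact ⟨a, c * b, n, by
      rw [← mul_assoc, ← mul_assoc, ← (pair_commute_LR a b).eq, mul_assoc (π (.coeffL a)),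
        pair_R_mul]⟩

lemma IsHaarNormal.haarBlock_mul (hU : IsHaarBiUnitary P Uₗ Uᵣ)
    {q : A × Module.End ℂ (HaarModule B)} (h : IsHaarNormal P Uₗ Uᵣ q) (a : HaarLetter × B) :
    IsHaarNormal P Uₗ Uᵣ (haarBlock P Uₗ Uᵣ a * q) := by
  obtain ⟨z, b⟩ := a
  by_cases hz : z.IsLeft
  · rw [haarBlock_of_isLeft hz, mul_assoc]
    exact (h.pair_mul hU _).pair_mul hU _
  · rw [haarBlock_of_not_isLeft hz, mul_assoc]
    exact (h.pair_mul hU _).pair_mul hU _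

lemma isHaarNormal_blocks_mul (hU : IsHaarBiUnitary P Uₗ Uᵣ) (n : List (HaarLetter × B))
    (s : HaarSymbol B) :
    IsHaarNormal P Uₗ Uᵣ ((n.map (haarBlock P Uₗ Uᵣ)).prod * π s) := by
  induction n with
  | nil => simpa using isHaarNormal_one.pair_mul hU s
  | cons a n ih =>
    rw [List.map_cons, List.prod_cons, mul_assoc]
    exact ih.haarBlock_mul hU a

variable (P) in
/-- Both components have the same expectation. -/
def SameMoment (q : A × Module.End ℂ (HaarModule B)) : Prop :=
  P.E q.1 = haarExpectation q.2

lemma SameMoment.coeff_mul {q : A × Module.End ℂ (HaarModule B)} (h : SameMoment P q) (a c : B) :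
    SameMoment P (π (.coeffL a) * π (.coeffR c) * q) := by
  have h₁ : haarExpectation (opL (HaarModule B) a * opR (HaarModule B) c * q.2) =
      a * haarExpectation q.2 * c := by
    simp [haarExpectation, opL, opR, mul_assoc]
  have h₂ : P.E (P.L a * P.R c * q.1) = a * P.E q.1 * c := by
    rw [ProbSpace.L_mul_R, P.E_mul]
  exact h₂.trans ((congrArg (fun x => a * x * c) h).trans h₁.symm)

/-- In 𝒜 this is the axiom `E_left_eq_right`; on ℓ²(ℤ, B) it holds because `L_b` and `R_b` agree on
δ₀. -/
lemma sameMoment_swap {q : A × Module.End ℂ (HaarModule B)} (b : B) :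
    SameMoment P (q * π (.coeffL b)) ↔ SameMoment P (q * π (.coeffR b)) := by
  have h₁ : haarExpectation (q.2 * opL (HaarModule B) b) =
      haarExpectation (q.2 * opR (HaarModule B) b) := by
    simp [haarExpectation, opL, opR]
  have h₂ : P.E (q.1 * P.L b) = P.E (q.1 * P.R b) := P.E_left_eq_right b q.1
  exact ⟨fun h => h₂.symm.trans (h.trans h₁), fun h => h₂.trans (h.trans h₁.symm)⟩

lemma fst_list_prod {R S ι : Type*} [Monoid R] [Monoid S] (f : ι → R × S) (m : List ι) :
    (m.map f).prod.1 = (m.map fun i => (f i).1).prod := by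
  induction m with
  | nil => rfl
  | cons i m ih => simp [ih]

lemma snd_list_prod {R S ι : Type*} [Monoid R] [Monoid S] (f : ι → R × S) (m : List ι) :
    (m.map f).prod.2 = (m.map fun i => (f i).2).prod := by
  induction m with
  | nil => rfl
  | cons i m ih => simp [ih]

lemma sameMoment_blocks_unitary (hU : IsHaarBiUnitary P Uₗ Uᵣ) (n : List (HaarLetter × B))
    (z : HaarLetter) : SameMoment P ((n.map (haarBlock P Uₗ Uᵣ)).prod * π (.unitary z)) := by
  have h := hU.moments n z
  rw [SameMoment, Prod.fst_mul, Prod.snd_mul, fst_list_prod, snd_list_prod]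
  exact h

lemma IsHaarNormal.sameMoment_unitary (hU : IsHaarBiUnitary P Uₗ Uᵣ)
    {q : A × Module.End ℂ (HaarModule B)} (h : IsHaarNormal P Uₗ Uᵣ q) (z : HaarLetter) :
    SameMoment P (q * π (.unitary z)) := by
  obtain ⟨a, c, n, rfl⟩ := h
  rw [mul_assoc]
  exact (sameMoment_blocks_unitary hU n z).coeff_mul a c

lemma IsHaarBiUnitary.E_one (hU : IsHaarBiUnitary P Uₗ Uᵣ) : P.E 1 = 1 := by
  -- The moment of `U_ℓ L_1 U_ℓ⁻¹ = 1`.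
  have h := hU.moments [(.left, 1)] .leftInv
  have h₁ : opL (HaarModule B) (1 : B) = 1 := map_one (Algebra.lsmul ℂ ℂ (HaarModule B))
  simpa [HaarLetter.eval, HaarLetter.coeff, ProbSpace.L_one, HaarLetter.concrete,
    HaarLetter.concreteCoeff, h₁, haarExpectation] using h

/-- The prescribed moments end in a unitary letter, whereas a product of blocks ends in a
coefficient. -/
lemma sameMoment_blocks (hU : IsHaarBiUnitary P Uₗ Uᵣ) (n : List (HaarLetter × B)) :
    SameMoment P (n.map (haarBlock P Uₗ Uᵣ)).prod := by
  rcases List.eq_nil_or_concat n with rfl | ⟨n, ⟨z, b⟩, rfl⟩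
  · exact hU.E_one.trans (by simp [haarExpectation])
  · rw [List.concat_eq_append, List.map_append, List.prod_append, List.map_singleton,
      List.prod_singleton]
    by_cases hz : z.IsLeft
    -- Under the expectation the final `L_b` may be exchanged for `R_b`, which commutes past the
    -- left letter. The word then ends in a unitary, and renormalizing what precedes it reduces to
    -- the prescribed moments.
    · rw [haarBlock_of_isLeft hz, ← mul_assoc, sameMoment_swap, mul_assoc,
        (pair_unitary_commute_R hU hz b).eq, ← mul_assoc]
      exact (isHaarNormal_blocks_mul hU n _).sameMoment_unitary hU z
    · rw [haarBlock_of_not_isLeft hz, ← mul_assoc, ← sameMoment_swap, mul_assoc,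
        (pair_unitary_commute_L hU hz b).eq, ← mul_assoc]
      exact (isHaarNormal_blocks_mul hU n _).sameMoment_unitary hU z

/-- All words in `U_ℓ^{±1}, U_r^{±1}`, `L_b` and `R_b` have the moments of the concrete Haar
bi-unitary. -/
theorem IsHaarBiUnitary.moment_eq (hU : IsHaarBiUnitary P Uₗ Uᵣ) (m : List (HaarSymbol B)) :
    P.E (m.map fun s => (HaarSymbol.pair P Uₗ Uᵣ s).1).prod =
      haarExpectation (m.map fun s => (HaarSymbol.pair P Uₗ Uᵣ s).2).prod := by
  have h : IsHaarNormal P Uₗ Uᵣ (m.map (HaarSymbol.pair P Uₗ Uᵣ)).prod := by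
    induction m with
    | nil => exact isHaarNormal_one
    | cons s m ih =>
      rw [List.map_cons, List.prod_cons]
      exact ih.pair_mul hU s
  rw [← fst_list_prod, ← snd_list_prod]
  obtain ⟨a, c, n, hq⟩ := h
  rw [hq]
  exact (sameMoment_blocks hU n).coeff_mul a c

end HaarMoments

/-! ### The Haar bimodule and the universal bimodule of a probability space -/

section Haar

variable (B : Type u) [Ring B] [Algebra ℂ B]

/-- `ℓ²(ℤ, B)` with the vector `δ₀`. -/
def haarState : StateSpace B (HaarModule B) where
  actL := Algebra.lsmul ℂ ℂ (HaarModule B)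
  actR := Algebra.lsmul ℂ ℂ (HaarModule B)
  comm b c := LinearMap.ext fun f => smul_comm b c f
  p := Finsupp.lapply 0
  p_actL b f := by simp
  p_actR b f := by simp
  ξ := Finsupp.single 0 1
  central b := by simp
  p_ξ := by simp

/-- `ℓ²(ℤ, B) = B δ₀ ⊕ (B δ₀)^⊥`, given by the second summand. -/
def haarBimodule : BBimodule.{u, max u w} B := StateSpace.kerBimodule.{u, u, w} (haarState B)

lemma haarState_actR_comm (z : HaarLetter) (b : Bᵐᵒᵖ) :
    Commute ((haarState B).actR b) (z.concrete B) :=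
  (z.concrete_commute_opR b.unop).symm

lemma haarState_actL_comm (z : HaarLetter) (b : B) :
    Commute ((haarState B).actL b) (z.concrete B) :=
  (z.concrete_commute_opL b).symm

/-- The letters of the concrete Haar bi-unitary as left operators. -/
def haarLeft (z : HaarLetter) : leftOperators (haarBimodule.{u, w} B) :=
  ⟨StateSpace.transport.{u, u, w} (haarState B) (z.concrete B),
    StateSpace.transport_mem_leftOperators _ (haarState_actR_comm B z)⟩

/-- The letters of the concrete Haar bi-unitary as right operators. -/
def haarRight (z : HaarLetter) : rightOperators (haarBimodule.{u, w} B) :=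
  ⟨StateSpace.transport.{u, u, w} (haarState B) (z.concrete B),
    StateSpace.transport_mem_rightOperators _ (haarState_actL_comm B z)⟩

lemma haarShift_single (n : ℤ) (b : B) :
    haarShift B (Finsupp.single n b) = Finsupp.single (n - 1) b := by
  simp [haarShift]

lemma haarShift_symm_single (n : ℤ) (b : B) :
    (haarShift B).symm (Finsupp.single n b) = Finsupp.single (n + 1) b := by
  rw [LinearEquiv.symm_apply_eq, haarShift_single, add_sub_cancel_right]

/-- The vector `δ_n` for `n ≠ 0`. -/
def haarDelta (n : ℤ) (hn : n ≠ 0) : (haarBimodule.{u, w} B).carrier :=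
  StateSpace.kerMk.{u, u, w} (haarState B) (Finsupp.single n 1) (by simp [haarState, hn.symm, hn])

/-- The concrete Haar bi-unitary as a pointed shift. -/
def haarPointedShift : PointedShift (haarBimodule.{u, w} B) where
  shiftL := haarLeft B .left
  invL := haarLeft B .leftInv
  shiftR := haarRight B .right
  invR := haarRight B .rightInv
  pos := haarDelta B 1 (by decide)
  neg := haarDelta B (-1) (by decide)
  shiftR_eq := rfl
  invR_eq := rfl
  shift_one := (haarState B).transport_one_eq
    ((haarShift_single B 0 1).trans (by rw [zero_sub]; rfl))
  shift_pos := (haarState B).transport_eq_one (haarShift_single B 1 1)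
  inv_one := (haarState B).transport_one_eq (haarShift_symm_single B 0 1)
  inv_neg := (haarState B).transport_eq_one (haarShift_symm_single B (-1) 1)

lemma haarExpectation_eq (T : Module.End ℂ (HaarModule B)) :
    haarExpectation T =
      (StateSpace.transport.{u, u, w} (haarState B) T (1, 0)).1 :=
  ((haarState B).transport_one_fst T).symm

end Haar

section Universal

variable {B : Type u} {A : Type v} [Ring B] [Algebra ℂ B] [Ring A] [Algebra ℂ A]
  (P : ProbSpace B A)

/-- The left ideal of `𝒜` generated by the elements `L_b - R_b`. -/
def ProbSpace.balanceIdeal : Submodule ℂ A :=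
  Submodule.span ℂ {x | ∃ a b, x = a * (P.L b - P.R b)}

lemma ProbSpace.mul_mem_balanceIdeal (a : A) :
    P.balanceIdeal ≤ P.balanceIdeal.comap (LinearMap.mulLeft ℂ a) :=
  Submodule.span_le.2 (by
    rintro _ ⟨c, b, rfl⟩
    exact Submodule.subset_span ⟨a * c, b, by simp [mul_assoc]⟩)

/-- This lets `E` descend to the quotient, in which the class of `1` has become a central vector. -/
lemma ProbSpace.balanceIdeal_le_ker : P.balanceIdeal ≤ LinearMap.ker P.E :=
  Submodule.span_le.2 (by
    rintro _ ⟨a, b, rfl⟩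
    have h : P.E (a * P.L b) = P.E (a * P.R b) := P.E_left_eq_right b a
    rw [SetLike.mem_coe, LinearMap.mem_ker, mul_sub, map_sub, h, sub_self])

/-- Left multiplication on `𝒜` modulo `balanceIdeal`. -/
def ProbSpace.act : A →ₐ[ℂ] Module.End ℂ (A ⧸ P.balanceIdeal) :=
  AlgHom.ofLinearMap
    { toFun := fun a => P.balanceIdeal.mapQ P.balanceIdeal (LinearMap.mulLeft ℂ a)
        (P.mul_mem_balanceIdeal a)
      map_add' := fun a b => Submodule.linearMap_qext _ (LinearMap.ext fun x => by simp [add_mul])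
      map_smul' := fun c a => Submodule.linearMap_qext _ (LinearMap.ext fun x => by simp) }
    (Submodule.linearMap_qext _ (LinearMap.ext fun x => by simp))
    fun a b => Submodule.linearMap_qext _ (LinearMap.ext fun x => by simp [mul_assoc])

variable {P}

/-- `𝒜` modulo `balanceIdeal`, with the vector state induced by `E`. -/
def universalState (hE : P.E 1 = 1) : StateSpace B (A ⧸ P.balanceIdeal) where
  actL := P.act.comp (P.ε.comp Algebra.TensorProduct.includeLeft)
  actR := P.act.comp (P.ε.comp Algebra.TensorProduct.includeRight)
  comm b c := by
    have h : Commute (b ⊗ₜ[ℂ] (1 : Bᵐᵒᵖ)) ((1 : B) ⊗ₜ[ℂ] c) := by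
      simp [commute_iff_eq]
    exact h.map (P.act.comp P.ε)
  p := P.balanceIdeal.liftQ P.E P.balanceIdeal_le_ker
  p_actL b v := by
    obtain ⟨x, rfl⟩ := Submodule.Quotient.mk_surjective _ v
    have h := P.E_mul b 1 x
    rw [mul_one] at h
    exact h
  p_actR b v := by
    obtain ⟨x, rfl⟩ := Submodule.Quotient.mk_surjective _ v
    have h := P.E_mul 1 b x
    rw [one_mul] at h
    exact h
  ξ := Submodule.Quotient.mk 1
  central b := (Submodule.Quotient.eq _).2 (Submodule.subset_span
    ⟨1, b, by
      change P.L b * 1 - P.R b * 1 = _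
      rw [mul_one, mul_one, one_mul]⟩)
  p_ξ := hE

/-- `𝒜` modulo `balanceIdeal` as a pointed bimodule. -/
def universalBimodule (hE : P.E 1 = 1) : BBimodule.{u, max u v} B :=
  StateSpace.kerBimodule.{u, v, u} (universalState hE)

/-- The action of `𝒜` on the universal bimodule. -/
def universalAct (hE : P.E 1 = 1) : A →ₐ[ℂ] Module.End ℂ (Pointed (universalBimodule hE)) :=
  (StateSpace.transport.{u, v, u} (universalState hE)).comp P.act

lemma universalAct_L (hE : P.E 1 = 1) (b : B) :
    universalAct hE (P.L b) = opL (Pointed (universalBimodule hE)) b :=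
  StateSpace.transport_actL.{u, v, u} (universalState hE) b

lemma universalAct_R (hE : P.E 1 = 1) (b : B) :
    universalAct hE (P.R b) = opR (Pointed (universalBimodule hE)) b :=
  StateSpace.transport_actR.{u, v, u} (universalState hE) b

lemma universalAct_one_fst (hE : P.E 1 = 1) (a : A) : (universalAct hE a (1, 0)).1 = P.E a := by
  refine (StateSpace.transport_one_fst.{u, v, u} (universalState hE) (P.act a)).trans ?_
  have h : P.act a (universalState hE).ξ = Submodule.Quotient.mk (a * 1) := rfl
  rw [h, mul_one]
  rfl

/-- The left algebra acts by left operators. -/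
def universalLeft (hE : P.E 1 = 1) : P.leftAlg →ₐ[ℂ] leftOperators (universalBimodule hE) :=
  ((universalAct hE).comp P.leftAlg.val).codRestrict _ fun a => by
    rw [leftOperators, Subalgebra.mem_centralizer_iff]
    rintro _ ⟨b, rfl⟩
    have h := (Subalgebra.mem_centralizer_iff ℂ).1 a.2 _ ⟨b, rfl⟩
    have h' := congrArg (universalAct hE) h
    rwa [map_mul, map_mul, universalAct_R] at h'

/-- The right algebra acts by right operators. -/
def universalRight (hE : P.E 1 = 1) : P.rightAlg →ₐ[ℂ] rightOperators (universalBimodule hE) :=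
  ((universalAct hE).comp P.rightAlg.val).codRestrict _ fun a => by
    rw [rightOperators, Subalgebra.mem_centralizer_iff]
    rintro _ ⟨b, rfl⟩
    have h := (Subalgebra.mem_centralizer_iff ℂ).1 a.2 _ ⟨b, rfl⟩
    have h' := congrArg (universalAct hE) h
    rwa [map_mul, map_mul, universalAct_L] at h'

end Universal

/-! ### Bi-freeness of the conjugated pair -/

section Faces

variable {B : Type u} {A : Type v} [Ring B] [Algebra ℂ B] [Ring A] [Algebra ℂ A]
  {P : ProbSpace B A}

/-- If two families in algebras have the same moments, the expectations agree on the algebra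
generated by the pairs. -/
lemma moments_adjoin {A₁ A₂ Y ι : Type*} [Ring A₁] [Algebra ℂ A₁] [Ring A₂] [Algebra ℂ A₂]
    [AddCommGroup Y] [Module ℂ Y] (φ₁ : A₁ →ₗ[ℂ] Y) (φ₂ : A₂ →ₗ[ℂ] Y) (γ : ι → A₁ × A₂)
    (h : ∀ m : List ι, φ₁ (m.map fun i => (γ i).1).prod = φ₂ (m.map fun i => (γ i).2).prod)
    {g : A₁ × A₂} (hg : g ∈ Algebra.adjoin ℂ (Set.range γ)) : φ₁ g.1 = φ₂ g.2 := by
  have hle : Subalgebra.toSubmodule (Algebra.adjoin ℂ (Set.range γ)) ≤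
      LinearMap.eqLocus (φ₁ ∘ₗ LinearMap.fst ℂ A₁ A₂) (φ₂ ∘ₗ LinearMap.snd ℂ A₁ A₂) := by
    rw [Algebra.adjoin_eq_span, Submodule.span_le]
    intro q hq
    obtain ⟨m, hm, rfl⟩ := Submonoid.exists_list_of_mem_closure hq
    obtain ⟨m, rfl⟩ : ∃ m' : List ι, m'.map γ = m := by
      rwa [← Set.mem_range, Set.range_list_map]
    have := h m
    rw [← fst_list_prod, ← snd_list_prod] at this
    exact this
  exact hle hg

/-- The expectation on the operators of a free product, as a linear map. -/
def freeExpectationₗ {K : Type*} (X : K → BBimodule.{u, w} B) :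
    Module.End ℂ (FreeProd X) →ₗ[ℂ] B :=
  vectorState X ∘ₗ LinearMap.applyₗ (tens X 1 [])

variable {F : FacePair P}

/-- A letter as an operator on a pointed bimodule. -/
def faceLocal {X : BBimodule.{u, w} B} (l : F.left →ₐ[ℂ] leftOperators X)
    (r : F.right →ₐ[ℂ] rightOperators X) : Letter F → Module.End ℂ (Pointed X)
  | .left c => (l c).1
  | .right d => (r d).1
  | .coeffL b => opL (Pointed X) b
  | .coeffR b => opR (Pointed X) b

/-- A letter as an operator on a free product. -/
def faceOp {K : Type*} (X : K → BBimodule.{u, w} B) (k : K)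
    (l : F.left →ₐ[ℂ] leftOperators (X k)) (r : F.right →ₐ[ℂ] rightOperators (X k)) :
    Letter F → Module.End ℂ (FreeProd X)
  | .left c => leftAct k (l c)
  | .right d => rightAct k (r d)
  | .coeffL b => freeL X b
  | .coeffR b => freeR X b

lemma modelEval_eq_faceOp {K : Type*} {F : K → FacePair P} (X : K → BBimodule.{u, w} B)
    (l : ∀ k, (F k).left →ₐ[ℂ] leftOperators (X k))
    (r : ∀ k, (F k).right →ₐ[ℂ] rightOperators (X k)) (k : K) (s : Letter (F k)) :
    modelEval X l r ⟨k, s⟩ = faceOp X k (l k) (r k) s := by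
  cases s <;> rfl

/-- The moments of one face pair on the free product are those on its factor. -/
lemma freeExpectation_faceOp {K : Type*} {X : K → BBimodule.{u, w} B} (k : K)
    (l : F.left →ₐ[ℂ] leftOperators (X k)) (r : F.right →ₐ[ℂ] rightOperators (X k))
    {ι : Type*} (f : ι → Letter F) (m : List ι) :
    freeExpectation X (m.map fun i => faceOp X k l r (f i)).prod =
      ((m.map fun i => faceLocal l r (f i)).prod (1, 0)).1 :=
  freeExpectation_prod_of_restrict k _ _ (fun i v => by
    cases f i with
    | left c => exact leftAct_consVec (Word.fresh_nil k) (l c) v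
    | right d => exact rightAct_consVec_nil k (r d) v
    | coeffL b => exact freeL_consVec k b v []
    | coeffR b => exact freeR_consVec_nil k b v) m

/-- Letters of a pair of faces and of its conjugate, as operators on a free product of two
bimodules, the conjugating operators acting on the second one. -/
def conjOp {Y : Fin 2 → BBimodule.{u, w} B} (l : F.left →ₐ[ℂ] leftOperators (Y 0))
    (r : F.right →ₐ[ℂ] rightOperators (Y 0)) (a a' : leftOperators (Y 1))
    (s s' : rightOperators (Y 1)) : Letter F ⊕ Letter F → Module.End ℂ (FreeProd Y)
  | .inl t => faceOp Y 0 l r t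
  | .inr (.left c) => leftAct 1 a' * leftAct 0 (l c) * leftAct 1 a
  | .inr (.right d) => rightAct 1 s * rightAct 0 (r d) * rightAct 1 s'
  | .inr (.coeffL b) => freeL Y b
  | .inr (.coeffR b) => freeR Y b

end Faces

section Main

variable {B : Type u} {A : Type v} [Ring B] [Algebra ℂ B] [Ring A] [Algebra ℂ A]
  {P : ProbSpace B A} (F : FacePair P) {Uₗ Uᵣ : Aˣ} (hU : IsHaarBiUnitary P Uₗ Uᵣ)

/-- `U_ℓ` in the left face of the generated pair. -/
def unitL : (generatedPair hU).left :=
  ⟨Uₗ, Algebra.subset_adjoin (by simp)⟩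

/-- `U_ℓ⁻¹` in the left face of the generated pair. -/
def unitLInv : (generatedPair hU).left :=
  ⟨(Uₗ⁻¹ : Aˣ), Algebra.subset_adjoin (by simp)⟩

/-- `U_r` in the right face of the generated pair. -/
def unitR : (generatedPair hU).right :=
  ⟨Uᵣ, Algebra.subset_adjoin (by simp)⟩

/-- `U_r⁻¹` in the right face of the generated pair. -/
def unitRInv : (generatedPair hU).right :=
  ⟨(Uᵣ⁻¹ : Aˣ), Algebra.subset_adjoin (by simp)⟩

/-- The letter of the generated pair that corresponds to a Haar symbol. -/
def symbolLetter : HaarSymbol B → Letter (generatedPair hU)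
  | .unitary .left => .left (unitL hU)
  | .unitary .leftInv => .left (unitLInv hU)
  | .unitary .right => .right (unitR hU)
  | .unitary .rightInv => .right (unitRInv hU)
  | .coeffL b => .coeffL b
  | .coeffR b => .coeffR b

lemma symbolLetter_eval (s : HaarSymbol B) :
    (symbolLetter hU s).eval = (HaarSymbol.pair P Uₗ Uᵣ s).1 := by
  rcases s with (_ | _ | _ | _) | b | b <;> rfl

/-- The value in `𝒜` of the letters of a pair of faces and of its conjugate. -/
def conjPairEval (Uₗ Uᵣ : Aˣ) : Letter F ⊕ Letter F → A
  | .inl t => t.eval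
  | .inr t => t.conjEval Uₗ Uᵣ

/-- The conjugate `U_ℓ⁻¹ c U_ℓ`. -/
def conjLeft (c : F.left) : (conjugatePair F hU).left :=
  ⟨((Uₗ⁻¹ : Aˣ) : A) * c * (Uₗ : A), Algebra.subset_adjoin (Or.inr ⟨c, c.2, rfl⟩)⟩

/-- The conjugate `U_r d U_r⁻¹`. -/
def conjRight (d : F.right) : (conjugatePair F hU).right :=
  ⟨(Uᵣ : A) * d * ((Uᵣ⁻¹ : Aˣ) : A), Algebra.subset_adjoin (Or.inr ⟨d, d.2, rfl⟩)⟩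

/-- The letter of the conjugate pair that corresponds to a letter of `F`. -/
def conjLetter : Letter F → Letter (conjugatePair F hU)
  | .left c => .left (conjLeft F hU c)
  | .right d => .right (conjRight F hU d)
  | .coeffL b => .coeffL b
  | .coeffR b => .coeffR b

variable {F}

lemma conjLetter_eval (s : Letter F) : (conjLetter F hU s).eval = s.conjEval Uₗ Uᵣ := by
  cases s <;> rfl

/-- The left representation of a pair of faces on the universal bimodule. -/
def universalFaceLeft (hE : P.E 1 = 1) (F : FacePair P) :
    F.left →ₐ[ℂ] leftOperators (universalBimodule hE) :=
  (universalLeft hE).comp (Subalgebra.inclusion F.left_le)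

/-- The right representation of a pair of faces on the universal bimodule. -/
def universalFaceRight (hE : P.E 1 = 1) (F : FacePair P) :
    F.right →ₐ[ℂ] rightOperators (universalBimodule hE) :=
  (universalRight hE).comp (Subalgebra.inclusion F.right_le)

/-- On the universal bimodule the elements `L_b` and `R_b` of 𝒜 act as the bimodule operators, so
all letters come from a single homomorphism on 𝒜. -/
lemma faceLocal_universal (hE : P.E 1 = 1) (s : Letter F) :
    faceLocal (universalFaceLeft hE F) (universalFaceRight hE F) s =
      universalAct hE s.eval := by
  cases s with
  | left c => rfl
  | right d => rfl
  | coeffL b => exact (universalAct_L hE b).symm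
  | coeffR b => exact (universalAct_R hE b).symm

lemma faceLocal_universal_moment (hE : P.E 1 = 1) {ι : Type*} (f : ι → Letter F) (m : List ι) :
    ((m.map fun i => faceLocal (universalFaceLeft hE F) (universalFaceRight hE F) (f i)).prod
      (1, 0)).1 = P.E (m.map fun i => (f i).eval).prod := by
  simp only [faceLocal_universal]
  rw [← universalAct_one_fst hE, map_list_prod, List.map_map]
  rfl

end Main

/-! ### Comparison of the given model, the Haar model and the free product of two copies -/

section Model

variable {B : Type u} {A : Type v} [Ring B] [Algebra ℂ B] [Ring A] [Algebra ℂ A]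
  {P : ProbSpace B A} {F : FacePair P} {Uₗ Uᵣ : Aˣ} {hU : IsHaarBiUnitary P Uₗ Uᵣ}

/-- A model on a free product of two bimodules for the joint distribution of a pair of faces and
the pair generated by a Haar bi-unitary. -/
structure HaarModel (F : FacePair P) (hU : IsHaarBiUnitary P Uₗ Uᵣ) where
  X : Fin 2 → BBimodule.{u, max u v} B
  l₀ : F.left →ₐ[ℂ] leftOperators (X 0)
  r₀ : F.right →ₐ[ℂ] rightOperators (X 0)
  l₁ : (generatedPair hU).left →ₐ[ℂ] leftOperators (X 1)
  r₁ : (generatedPair hU).right →ₐ[ℂ] rightOperators (X 1)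
  moment_eq : ∀ m : List (Letter F ⊕ Letter (generatedPair hU)),
    P.E (m.map (Sum.elim Letter.eval Letter.eval)).prod =
      freeExpectation X (m.map (Sum.elim (faceOp X 0 l₀ r₀) (faceOp X 1 l₁ r₁))).prod

namespace HaarModel

variable (M : HaarModel F hU)

/-- The values of the letters in `𝒜` and in the model. -/
def letterPair (i : Letter F ⊕ Letter (generatedPair hU)) : A × Module.End ℂ (FreeProd M.X) :=
  (Sum.elim Letter.eval Letter.eval i, Sum.elim (faceOp M.X 0 M.l₀ M.r₀) (faceOp M.X 1 M.l₁ M.r₁) i)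

/-- The letters of `F` and their conjugates in the model. -/
def opModel : Letter F ⊕ Letter F → Module.End ℂ (FreeProd M.X) :=
  conjOp M.l₀ M.r₀ (M.l₁ (unitL hU)) (M.l₁ (unitLInv hU)) (M.r₁ (unitR hU)) (M.r₁ (unitRInv hU))

/-- A conjugated letter is a product of letters of the given model, with the same product in both
components. -/
lemma pair_mem_adjoin (j : Letter F ⊕ Letter F) :
    (conjPairEval F Uₗ Uᵣ j, M.opModel j) ∈ Algebra.adjoin ℂ (Set.range M.letterPair) := by
  have h : ∀ i, M.letterPair i ∈ Algebra.adjoin ℂ (Set.range M.letterPair) :=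
    fun i => Algebra.subset_adjoin ⟨i, rfl⟩
  rcases j with t | c | d | b | b
  · exact h (.inl t)
  · exact mul_mem (mul_mem (h (.inr (.left (unitLInv hU)))) (h (.inl (.left c))))
      (h (.inr (.left (unitL hU))))
  · exact mul_mem (mul_mem (h (.inr (.right (unitR hU)))) (h (.inl (.right d))))
      (h (.inr (.right (unitRInv hU))))
  · exact h (.inl (.coeffL b))
  · exact h (.inl (.coeffR b))

lemma E_eq_opModel (m : List (Letter F ⊕ Letter F)) :
    P.E (m.map (conjPairEval F Uₗ Uᵣ)).prod = freeExpectation M.X (m.map M.opModel).prod := by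
  have hm : (m.map fun j => (conjPairEval F Uₗ Uᵣ j, M.opModel j)).prod ∈
      Algebra.adjoin ℂ (Set.range M.letterPair) :=
    Subalgebra.list_prod_mem _ fun x hx => by
      obtain ⟨j, -, rfl⟩ := List.mem_map.1 hx
      exact M.pair_mem_adjoin j
  have h := moments_adjoin P.E (freeExpectationₗ M.X) M.letterPair M.moment_eq hm
  rwa [fst_list_prod, snd_list_prod] at h

/-- The free product of `𝒳₀` with the Haar bimodule. -/
def haarFamily : Fin 2 → BBimodule.{u, max u v} B := ![M.X 0, haarBimodule.{u, max u v} B]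

/-- The concrete Haar bi-unitary on the second factor of `haarFamily`. -/
def shift : PointedShift (M.haarFamily 1) := haarPointedShift.{u, max u v} B

/-- The letters of `F` and their conjugates by the concrete Haar bi-unitary. -/
def opHaar : Letter F ⊕ Letter F → Module.End ℂ (FreeProd M.haarFamily) :=
  conjOp (Y := M.haarFamily) M.l₀ M.r₀ M.shift.shiftL M.shift.invL M.shift.shiftR M.shift.invR

lemma E_generated (m : List (HaarSymbol B)) :
    P.E (m.map fun s => (symbolLetter hU s).eval).prod =
      ((m.map fun s => faceLocal M.l₁ M.r₁ (symbolLetter hU s)).prod (1, 0)).1 := by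
  have h := M.moment_eq (m.map fun s => Sum.inr (symbolLetter hU s))
  rw [List.map_map, List.map_map] at h
  exact h.trans (freeExpectation_faceOp 1 M.l₁ M.r₁ (symbolLetter hU) m)

/-- The relation between `𝒳₁` and the Haar bimodule generated by the Haar bi-unitary. -/
def haarRel : PointedRel (M.X 1) (haarBimodule.{u, max u v} B) :=
  PointedRel.cyclic (S := HaarSymbol B) (fun s => faceLocal M.l₁ M.r₁ (symbolLetter hU s))
    (fun s => StateSpace.transport.{u, u, max u v} (haarState B) (HaarSymbol.pair P Uₗ Uᵣ s).2)
    (fun b => ⟨.coeffL b, rfl, StateSpace.transport_actL.{u, u, max u v} (haarState B) b⟩)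
    (fun b => ⟨.coeffR b, rfl, StateSpace.transport_actR.{u, u, max u v} (haarState B) b⟩)
    (fun m => by
      rw [← M.E_generated]
      simp only [symbolLetter_eval]
      -- The moments on 𝒳₁ are those in 𝒜, which are the concrete ones for arbitrary words with
      -- coefficients.
      rw [hU.moment_eq, haarExpectation_eq.{u, max u v}, map_list_prod, List.map_map]
      rfl)

lemma haarRel_preserves (s : HaarSymbol B) :
    Preserves M.haarRel.rel (faceLocal M.l₁ M.r₁ (symbolLetter hU s))
      (StateSpace.transport.{u, u, max u v} (haarState B) (HaarSymbol.pair P Uₗ Uᵣ s).2) :=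
  PointedRel.cyclic_preserves (S := HaarSymbol B) _ _ _ s

/-- The relation of a pointed bimodule with itself generated by the letters of `F`. -/
def selfRel : PointedRel (M.X 0) (M.X 0) :=
  PointedRel.cyclic (faceLocal M.l₀ M.r₀) (faceLocal M.l₀ M.r₀) (fun b => ⟨.coeffL b, rfl, rfl⟩)
    (fun b => ⟨.coeffR b, rfl, rfl⟩) fun _ => rfl

lemma selfRel_preserves (s : Letter F) :
    Preserves M.selfRel.rel (faceLocal M.l₀ M.r₀ s) (faceLocal M.l₀ M.r₀ s) :=
  PointedRel.cyclic_preserves _ _ _ s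

/-- The relations between the factors of the model and of `haarFamily`. -/
def modelRel : ∀ k, PointedRel (M.X k) (M.haarFamily k)
  | 0 => M.selfRel
  | 1 => M.haarRel

/-- Here the unknown factor 𝒳₁ is exchanged for ℓ²(ℤ, B), with 𝒳₀ and its representations unchanged.
-/
lemma preserves_opHaar (j : Letter F ⊕ Letter F) :
    Preserves (PointedRel.free M.modelRel) (M.opModel j) (M.opHaar j) := by
  have hl : ∀ c, Preserves (PointedRel.free M.modelRel) (leftAct (X := M.X) 0 (M.l₀ c))
      (leftAct (X := M.haarFamily) 0 (M.l₀ c)) :=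
    fun c => PointedRel.preserves_leftAct (R := M.modelRel) 0 (M.selfRel_preserves (.left c))
  have hr : ∀ d, Preserves (PointedRel.free M.modelRel) (rightAct (X := M.X) 0 (M.r₀ d))
      (rightAct (X := M.haarFamily) 0 (M.r₀ d)) :=
    fun d => PointedRel.preserves_rightAct (R := M.modelRel) 0 (M.selfRel_preserves (.right d))
  rcases j with (c | d | b | b) | (c | d | b | b)
  · exact hl c
  · exact hr d
  · exact PointedRel.preserves_freeL M.modelRel b
  · exact PointedRel.preserves_freeR M.modelRel b
  · have h₁ := PointedRel.preserves_leftAct (R := M.modelRel) 1 (T := M.l₁ (unitLInv hU))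
      (T' := M.shift.invL) (M.haarRel_preserves (.unitary .leftInv))
    have h₂ := PointedRel.preserves_leftAct (R := M.modelRel) 1 (T := M.l₁ (unitL hU))
      (T' := M.shift.shiftL) (M.haarRel_preserves (.unitary .left))
    exact (h₁.mul (hl c)).mul h₂
  · have h₁ := PointedRel.preserves_rightAct (R := M.modelRel) 1 (T := M.r₁ (unitR hU))
      (T' := M.shift.shiftR) (M.haarRel_preserves (.unitary .right))
    have h₂ := PointedRel.preserves_rightAct (R := M.modelRel) 1 (T := M.r₁ (unitRInv hU))
      (T' := M.shift.invR) (M.haarRel_preserves (.unitary .rightInv))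
    exact (h₁.mul (hr d)).mul h₂
  · exact PointedRel.preserves_freeL M.modelRel b
  · exact PointedRel.preserves_freeR M.modelRel b

/-- The letters of `F` on the two factors of the free product of `𝒳₀` with itself. -/
def opSelf : Letter F ⊕ Letter F → Module.End ℂ (FreeProd fun _ : Fin 2 => M.X 0) :=
  Sum.elim (faceOp (fun _ => M.X 0) 0 M.l₀ M.r₀) (faceOp (fun _ => M.X 0) 1 M.l₀ M.r₀)

lemma preserves_opSelf (j : Letter F ⊕ Letter F) :
    Preserves M.shift.conjRel (M.opSelf j) (M.opHaar j) := by
  rcases j with (c | d | b | b) | (c | d | b | b)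
  · exact M.shift.preserves_leftAct_zero (M.l₀ c)
  · exact M.shift.preserves_rightAct_zero (M.r₀ d)
  · exact M.shift.preserves_freeL b
  · exact M.shift.preserves_freeR b
  · exact M.shift.preserves_leftAct_one (M.l₀ c)
  · exact M.shift.preserves_rightAct_one (M.r₀ d)
  · exact M.shift.preserves_freeL b
  · exact M.shift.preserves_freeR b

/-- The joint distribution of a pair of faces and its conjugate, on a free product. -/
theorem E_eq_opSelf (m : List (Letter F ⊕ Letter F)) :
    P.E (m.map (conjPairEval F Uₗ Uᵣ)).prod =
      freeExpectation (fun _ : Fin 2 => M.X 0) (m.map M.opSelf).prod := by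
  rw [M.E_eq_opModel, PointedRel.freeExpectation_eq M.modelRel M.preserves_opHaar]
  exact (M.shift.freeExpectation_eq M.preserves_opSelf m).symm

/-- Conjugated letters alone live on the second copy of 𝒳₀, so their moments are computed there. As
`E_eq_local` gives the same value for the original letters, the distributions agree. -/
lemma E_conj_eq_local (m : List (Letter F)) :
    P.E (m.map (Letter.conjEval Uₗ Uᵣ)).prod =
      ((m.map (faceLocal M.l₀ M.r₀)).prod (1, 0)).1 := by
  have h := M.E_eq_opSelf (m.map Sum.inr)
  rw [List.map_map, List.map_map] at h
  exact h.trans (freeExpectation_faceOp (X := fun _ : Fin 2 => M.X 0) 1 M.l₀ M.r₀ id m)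

lemma E_eq_local (m : List (Letter F)) :
    P.E (m.map Letter.eval).prod = ((m.map (faceLocal M.l₀ M.r₀)).prod (1, 0)).1 := by
  have h := M.E_eq_opSelf (m.map Sum.inl)
  rw [List.map_map, List.map_map] at h
  exact h.trans (freeExpectation_faceOp (X := fun _ : Fin 2 => M.X 0) 0 M.l₀ M.r₀ id m)

/-! ### A bi-free model for all elements of the conjugated pair -/

/-- The factors of the model for a pair of faces and its conjugate. -/
def conjFamily : Fin 2 → BBimodule.{u, max u v} B := ![M.X 0, universalBimodule hU.E_one]

/-- The relation between `𝒳₀` and the universal bimodule with the conjugate letters. -/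
def conjugateRel : PointedRel (M.X 0) (universalBimodule hU.E_one) :=
  PointedRel.cyclic (faceLocal M.l₀ M.r₀)
    (fun s => faceLocal (universalFaceLeft hU.E_one (conjugatePair F hU))
      (universalFaceRight hU.E_one (conjugatePair F hU)) (conjLetter F hU s))
    (fun b => ⟨.coeffL b, rfl, rfl⟩) (fun b => ⟨.coeffR b, rfl, rfl⟩) fun m => by
      rw [faceLocal_universal_moment hU.E_one (conjLetter F hU), ← M.E_conj_eq_local]
      simp only [conjLetter_eval]

lemma conjugateRel_preserves (s : Letter F) :
    Preserves M.conjugateRel.rel (faceLocal M.l₀ M.r₀ s)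
      (faceLocal (universalFaceLeft hU.E_one (conjugatePair F hU))
      (universalFaceRight hU.E_one (conjugatePair F hU)) (conjLetter F hU s)) :=
  PointedRel.cyclic_preserves _ _ _ s

/-- The relations between the factors of the free product of `𝒳₀` with itself and `conjFamily`. -/
def conjFamilyRel : ∀ k, PointedRel (M.X 0) (M.conjFamily k)
  | 0 => M.selfRel
  | 1 => M.conjugateRel

/-- The letters of the pair of faces and of its conjugate, on the free product of `conjFamily`. -/
def opFinal : Letter F ⊕ Letter (conjugatePair F hU) → Module.End ℂ (FreeProd M.conjFamily) :=
  Sum.elim (faceOp M.conjFamily 0 M.l₀ M.r₀)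
    (faceOp M.conjFamily 1 (universalFaceLeft hU.E_one (conjugatePair F hU))
      (universalFaceRight hU.E_one (conjugatePair F hU)))

/-- The second copy of 𝒳₀ is exchanged for the universal bimodule, where `conjLetter F hU` has the
same moments and all of `C'` and `D'` acts. -/
lemma preserves_opFinal (j : Letter F ⊕ Letter F) :
    Preserves (PointedRel.free M.conjFamilyRel) (M.opSelf j)
      (M.opFinal (j.map id (conjLetter F hU))) := by
  rcases j with (c | d | b | b) | (c | d | b | b)
  · exact PointedRel.preserves_leftAct (R := M.conjFamilyRel) 0 (M.selfRel_preserves (.left c))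
  · exact PointedRel.preserves_rightAct (R := M.conjFamilyRel) 0 (M.selfRel_preserves (.right d))
  · exact PointedRel.preserves_freeL M.conjFamilyRel b
  · exact PointedRel.preserves_freeR M.conjFamilyRel b
  · exact PointedRel.preserves_leftAct (R := M.conjFamilyRel) 1
      (M.conjugateRel_preserves (.left c))
  · exact PointedRel.preserves_rightAct (R := M.conjFamilyRel) 1
      (M.conjugateRel_preserves (.right d))
  · exact PointedRel.preserves_freeL M.conjFamilyRel b
  · exact PointedRel.preserves_freeR M.conjFamilyRel b

/-- The values of letters in `𝒜` and on the free product of `conjFamily`. -/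
def finalPair (i : Letter F ⊕ Letter (conjugatePair F hU)) :
    A × Module.End ℂ (FreeProd M.conjFamily) :=
  (Sum.elim Letter.eval Letter.eval i, M.opFinal i)

/-- The algebra generated by the letters of the pair of faces and their conjugates. -/
def generatedSubalgebra : Subalgebra ℂ (A × Module.End ℂ (FreeProd M.conjFamily)) :=
  Algebra.adjoin ℂ
    (Set.range fun j : Letter F ⊕ Letter F => M.finalPair (j.map id (conjLetter F hU)))

lemma finalPair_conj_mem (j : Letter F ⊕ Letter F) :
    M.finalPair (j.map id (conjLetter F hU)) ∈ M.generatedSubalgebra :=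
  Algebra.subset_adjoin ⟨j, rfl⟩

/-- Equality of moments for words in the generators extends by linearity to the algebra generated by
the pairs (element of 𝒜, operator). -/
lemma moments_generatedSubalgebra {g : A × Module.End ℂ (FreeProd M.conjFamily)}
    (hg : g ∈ M.generatedSubalgebra) : P.E g.1 = freeExpectation M.conjFamily g.2 := by
  refine moments_adjoin P.E (freeExpectationₗ M.conjFamily) _ (fun m => ?_) hg
  have h : ∀ j : Letter F ⊕ Letter F,
      (M.finalPair (j.map id (conjLetter F hU))).1 = conjPairEval F Uₗ Uᵣ j := by
    rintro (t | t)
    · rfl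
    · exact conjLetter_eval hU t
  simp only [h]
  exact (M.E_eq_opSelf m).trans
    (PointedRel.freeExpectation_eq M.conjFamilyRel M.preserves_opFinal m)

lemma finalPair_left_L (b : B) :
    M.finalPair (.inr (.left ⟨P.L b, (conjugatePair F hU).L_mem b⟩)) =
      M.finalPair (.inr (.coeffL b)) :=
  Prod.ext rfl (leftAct_eq_freeL 1 _ b (universalAct_L hU.E_one b))

lemma finalPair_right_R (b : B) :
    M.finalPair (.inr (.right ⟨P.R b, (conjugatePair F hU).R_mem b⟩)) =
      M.finalPair (.inr (.coeffR b)) :=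
  Prod.ext rfl (rightAct_eq_freeR 1 _ b (universalAct_R hU.E_one b))

lemma finalPair_left_add (c c' : (conjugatePair F hU).left) :
    M.finalPair (.inr (.left (c + c'))) =
      M.finalPair (.inr (.left c)) + M.finalPair (.inr (.left c')) :=
  Prod.ext rfl ((congrArg (leftAct 1) (map_add _ c c')).trans (leftAct_add _ _ _))

lemma finalPair_left_mul (c c' : (conjugatePair F hU).left) :
    M.finalPair (.inr (.left (c * c'))) =
      M.finalPair (.inr (.left c)) * M.finalPair (.inr (.left c')) :=
  Prod.ext rfl ((congrArg (leftAct 1) (map_mul _ c c')).trans (leftAct_mul _ _ _))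

lemma finalPair_right_add (d d' : (conjugatePair F hU).right) :
    M.finalPair (.inr (.right (d + d'))) =
      M.finalPair (.inr (.right d)) + M.finalPair (.inr (.right d')) :=
  Prod.ext rfl ((congrArg (rightAct 1) (map_add _ d d')).trans (rightAct_add _ _ _))

lemma finalPair_right_mul (d d' : (conjugatePair F hU).right) :
    M.finalPair (.inr (.right (d * d'))) =
      M.finalPair (.inr (.right d)) * M.finalPair (.inr (.right d')) :=
  Prod.ext rfl ((congrArg (rightAct 1) (map_mul _ d d')).trans (rightAct_mul _ _ _))

/-- For a fixed face, value and operator depend additively and multiplicatively on the element.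
Hence the elements whose pair lies in the subalgebra form a subalgebra containing the generators of
`C'` or `D'`. -/
lemma finalPair_mem (i : Letter F ⊕ Letter (conjugatePair F hU)) :
    M.finalPair i ∈ M.generatedSubalgebra := by
  have hL : ∀ b, M.finalPair (.inr (.left ⟨P.L b, (conjugatePair F hU).L_mem b⟩)) ∈
      M.generatedSubalgebra := fun b => by
    rw [finalPair_left_L]
    exact M.finalPair_conj_mem (.inr (.coeffL b))
  have hR : ∀ b, M.finalPair (.inr (.right ⟨P.R b, (conjugatePair F hU).R_mem b⟩)) ∈
      M.generatedSubalgebra := fun b => by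
    rw [finalPair_right_R]
    exact M.finalPair_conj_mem (.inr (.coeffR b))
  rcases i with t | ⟨⟨c, hc⟩⟩ | ⟨⟨d, hd⟩⟩ | b | b
  · exact M.finalPair_conj_mem (.inl t)
  · refine Algebra.adjoin_induction
      (p := fun x hx => M.finalPair (.inr (.left ⟨x, hx⟩)) ∈ M.generatedSubalgebra)
      ?_ ?_ ?_ ?_ hc
    · rintro _ (⟨b, rfl⟩ | ⟨c, hc, rfl⟩)
      · exact hL b
      · exact M.finalPair_conj_mem (.inr (.left ⟨c, hc⟩))
    · intro z
      -- Scalars are special cases of `L_b`, so they need no separate argument.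
      simp only [← P.L_algebraMap]
      exact hL _
    · intro x y hx hy h h'
      have := add_mem h h'
      rwa [← finalPair_left_add] at this
    · intro x y hx hy h h'
      have := mul_mem h h'
      rwa [← finalPair_left_mul] at this
  · refine Algebra.adjoin_induction
      (p := fun x hx => M.finalPair (.inr (.right ⟨x, hx⟩)) ∈ M.generatedSubalgebra)
      ?_ ?_ ?_ ?_ hd
    · rintro _ (⟨b, rfl⟩ | ⟨d, hd, rfl⟩)
      · exact hR b
      · exact M.finalPair_conj_mem (.inr (.right ⟨d, hd⟩))
    · intro z
      simp only [← P.R_algebraMap]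
      exact hR _
    · intro x y hx hy h h'
      have := add_mem h h'
      rwa [← finalPair_right_add] at this
    · intro x y hx hy h h'
      have := mul_mem h h'
      rwa [← finalPair_right_mul] at this
  · exact M.finalPair_conj_mem (.inr (.coeffL b))
  · exact M.finalPair_conj_mem (.inr (.coeffR b))

theorem E_eq_opFinal (m : List (Letter F ⊕ Letter (conjugatePair F hU))) :
    P.E (m.map (Sum.elim Letter.eval Letter.eval)).prod =
      freeExpectation M.conjFamily (m.map M.opFinal).prod := by
  have hm : (m.map M.finalPair).prod ∈ M.generatedSubalgebra :=
    Subalgebra.list_prod_mem _ fun x hx => by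
      obtain ⟨j, -, rfl⟩ := List.mem_map.1 hx
      exact M.finalPair_mem j
  have h := M.moments_generatedSubalgebra hm
  rwa [fst_list_prod, snd_list_prod] at h

end HaarModel

/-- Letters indexed by `Fin 2` as letters of the first or the second pair of faces. -/
def letterEquiv (F G : FacePair P) : (Σ k, Letter (![F, G] k)) ≃ Letter F ⊕ Letter G where
  toFun
    | ⟨0, s⟩ => .inl s
    | ⟨1, s⟩ => .inr s
  invFun
    | .inl s => ⟨0, s⟩
    | .inr s => ⟨1, s⟩
  left_inv := by rintro ⟨k, s⟩; fin_cases k <;> rfl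
  right_inv := by rintro (s | s) <;> rfl

theorem isBiFree_conjugatePair (F : FacePair P) (hU : IsHaarBiUnitary P Uₗ Uᵣ)
    (hfree : IsBiFree ![F, generatedPair hU]) :
    IsBiFree ![F, conjugatePair F hU] ∧
      ∀ m : List (Letter F), P.E (m.map (Letter.conjEval Uₗ Uᵣ)).prod =
        P.E (m.map Letter.eval).prod := by
  obtain ⟨X, l, r, h⟩ := hfree
  let M : HaarModel F hU :=
    { X := X
      l₀ := l 0
      r₀ := r 0
      l₁ := l 1
      r₁ := r 1
      moment_eq := fun m => by
        have h' := h (m.map (letterEquiv F (generatedPair hU)).symm)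
        rw [List.map_map, List.map_map] at h'
        convert h' using 4
        · funext i; rcases i with s | s <;> rfl
        · funext i
          rcases i with s | s
          · exact (modelEval_eq_faceOp X l r 0 s).symm
          · exact (modelEval_eq_faceOp X l r 1 s).symm }
  -- `(C, D)` keeps its original representations, and the conjugated pair acts on the universal
  -- bimodule.
  refine ⟨⟨M.conjFamily,
    fun k => match k with
      | 0 => M.l₀
      | 1 => universalFaceLeft hU.E_one (conjugatePair F hU),
    fun k => match k with
      | 0 => M.r₀
      | 1 => universalFaceRight hU.E_one (conjugatePair F hU), fun m => ?_⟩, fun m => ?_⟩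
  · have h' := M.E_eq_opFinal (m.map (letterEquiv F (conjugatePair F hU)))
    rw [List.map_map, List.map_map] at h'
    convert h' using 4
    · funext i
      obtain ⟨k, s⟩ := i
      fin_cases k <;> rfl
    · funext i
      obtain ⟨k, s⟩ := i
      rw [modelEval_eq_faceOp]
      fin_cases k <;> rfl
  · rw [M.E_conj_eq_local, M.E_eq_local]

end Model

end BiFree

end

theorem mainTheorem10 {B : Type u} {A : Type v} [Ring B] [Algebra ℂ B] [Ring A] [Algebra ℂ A]
    (P : BiFree.ProbSpace B A) (F : BiFree.FacePair P) (Uₗ Uᵣ : Aˣ)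
    (hU : BiFree.IsHaarBiUnitary P Uₗ Uᵣ)
    (hfree : BiFree.IsBiFree ![F, BiFree.generatedPair hU]) :
    BiFree.IsBiFree ![F, BiFree.conjugatePair F hU] ∧
      ∀ m : List (BiFree.Letter F),
        P.E (m.map (BiFree.Letter.conjEval Uₗ Uᵣ)).prod = P.E (m.map BiFree.Letter.eval).prod :=
  BiFree.isBiFree_conjugatePair F hU hfree
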